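/- Conventions. A $C^*$-category is a category whose morphism spaces $(\rho,\tau)$ are complex Banach spaces, with bilinear composition satisfying $\|S\circ R\|\le\|S\|\,\|R\|$, with an antilinear involutive contravariant functor $*$ that is the identity on objects and satisfies $\|R^*\circ R\|=\|R\|^2$, and with $(\rho,\rho)\neq 0$ for every object. It is a $C^*$-tensor category if it is monoidal with a bilinear product $\times$ of morphisms such that $(S\times T)^*=S^*\times T^*$ and with unitary associators and unitors (suppressed below). Write $\iota$ for the unit object. A subobject of $\rho$ corresponding to a projection $E\in(\rho,\rho)$ is an object $\pi$ with $V\in(\pi,\rho)$, $V^*\circ V=\mathbf 1_\pi$, $V\circ V^*=E$; $\pi$ is irreducible if $(\pi,\pi)=\mathbb C\mathbf 1_\pi$. Objects $\sigma,\bar\sigma$ are conjugate if there are $R\in(\iota,\bar\sigma\sigma)$, $\bar R\in(\iota,\sigma\bar\sigma)$ (a pair of conjugation operators) with $(\bar R^*\times\mathbf 1_\sigma)\circ(\mathbf 1_\sigma\times R)=\mathbf 1_\sigma$ and $(R^*\times\mathbf 1_{\bar\sigma})\circ(\mathbf 1_{\bar\sigma}\times\bar R)=\mathbf 1_{\bar\sigma}$.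 For irreducible $\sigma$ the pair is standard if $R^*\circ R=\bar R^*\circ\bar R$. For general $\sigma$ it is standard if $R=\sum_i(\overline W_i\times W_i)\circ R_i$ and $\bar R=\sum_i(W_i\times\overline W_i)\circ\bar R_i$, where $(R_i,\bar R_i)$ are standard pairs for irreducible $\sigma_i$ and conjugates $\bar\sigma_i$, and $W_i\in(\sigma_i,\sigma)$, $\overline W_i\in(\bar\sigma_i,\bar\sigma)$ are isometries with $\sum_iW_iW_i^*=\mathbf 1_\sigma$, $\sum_i\overline W_i\,\overline W_i^*=\mathbf 1_{\bar\sigma}$. The dimension $d(\sigma)$ is the number $R^*\circ R$ for a standard pair. A finite $C^*$-tensor category is one in which every nonzero projection has a corresponding subobject, any two objects have a direct sum, $\iota$ is irreducible, every object has a conjugate, and there are only finitely many irreducible objects up to unitary equivalence. $\mathrm{tr}_\rho$ is the trace on $(\rho,\rho)$ with $\mathrm{tr}_\rho(E)=d(\pi)/d(\rho)$ for each minimal projection $E$ and each subobject $\pi$ corresponding to $E$. For finite dimensional $*$-algebras $A\subset B$ and a faithful trace $\mathrm{tr}$ on $B$, the basic construction $B(A,B)$ is the $*$-algebra of operators on $L^2(B,\mathrm{tr})$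 generated by $B$ (acting by left multiplication) and the Jones projection $e$, i.e. the orthogonal projection onto $L^2(A)$. Lemma. Let $\rho,\sigma$ be objects of a finite $C^*$-tensor category, $\bar\sigma$ a conjugate of $\sigma$ and $(R_\sigma,\bar R_\sigma)$ a standard pair of conjugation operators for $\sigma$ and $\bar\sigma$. Consider the inclusions of finite dimensional $*$-algebras $$A=(\rho,\rho)\subset B=(\rho\sigma,\rho\sigma)\subset C=(\rho\sigma\bar\sigma,\rho\sigma\bar\sigma)$$ given by the injections $T\mapsto T\times\mathbf 1$. Let $B(A,B)$ be the basic construction for $A\subset B$ and the trace $\mathrm{tr}_{\rho\sigma}$ (which is a faithful normalized positive trace), with Jones projection $e$, and let $$f=\frac1{d(\sigma)}\,\mathbf 1_\rho\times(\bar R_\sigma\circ\bar R_\sigma^*)\in C .$$ Then $D=\operatorname{span}BfB$ is a two-sided ideal of $C$, and there is a $*$-isomorphism $\alpha$ from $B(A,B)$ onto $D$ such that $\alpha(e)=f$ and $\alpha(bx)=b\,\alpha(x)$, $\alpha(xb)=\alpha(x)\,b$ for $b\in B$, $x\in B(A,B)$. If every irreducible subobject of $\rho\sigma\bar\sigma$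 is a subobject of $\rho$, then $D=C$ and $\alpha|_B=\mathrm{id}_B$. Moreover the Markov relation $$\mathrm{tr}_{\rho\sigma\bar\sigma}\bigl((X\times\mathbf 1_{\bar\sigma})\circ f\bigr)=\frac1{d(\sigma)^2}\,\mathrm{tr}_{\rho\sigma}(X)\qquad(X\in(\rho\sigma,\rho\sigma))$$ holds. The same statements hold for $A=(\rho,\rho)$, $B=(\sigma\rho,\sigma\rho)$, $C=(\bar\sigma\sigma\rho,\bar\sigma\sigma\rho)$ with the injections $T\mapsto\mathbf 1\times T$, the trace $\mathrm{tr}_{\sigma\rho}$ on $B$, $f=\frac1{d(\sigma)}(R_\sigma\circ R_\sigma^*)\times\mathbf 1_\rho$, and (for the equality $D=C$ and $\alpha|_B=\mathrm{id}_B$) the hypothesis that every irreducible subobject of $\bar\sigma\sigma\rho$ is a subobject of $\rho$; the Markov relation is then $$\mathrm{tr}_{\bar\sigma\sigma\rho}\bigl((\mathbf 1_{\bar\sigma}\times X)\circ f\bigr)=\frac1{d(\sigma)^2}\,\mathrm{tr}_{\sigma\rho}(X)\qquad(X\in(\sigma\rho,\sigma\rho)).$$ -/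

import Mathlib

open CategoryTheory MonoidalCategory

universe v u w

noncomputable section

namespace CStarTC

/-! ### C*-categories -/

/-- A `C*`-category: the morphism spaces are complex Banach spaces, composition is bilinear and
submultiplicative for the norm, `dag` is an antilinear involutive contravariant functor which is
the identity on objects and satisfies the `C*`-identity `‖R* ∘ R‖ = ‖R‖ ^ 2`, and all
endomorphism spaces are nonzero. (`f ≫ g` is `g ∘ f`.) -/
class CStarCategory (𝒞 : Type u) [Category.{v} 𝒞] where
  homNormed : ∀ X Y : 𝒞, NormedAddCommGroup (X ⟶ Y)
  homSpace : ∀ X Y : 𝒞, NormedSpace ℂ (X ⟶ Y)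
  homComplete : ∀ X Y : 𝒞, CompleteSpace (X ⟶ Y)
  add_comp : ∀ {X Y Z : 𝒞} (f f' : X ⟶ Y) (g : Y ⟶ Z), (f + f') ≫ g = f ≫ g + f' ≫ g
  comp_add : ∀ {X Y Z : 𝒞} (f : X ⟶ Y) (g g' : Y ⟶ Z), f ≫ (g + g') = f ≫ g + f ≫ g'
  smul_comp : ∀ {X Y Z : 𝒞} (c : ℂ) (f : X ⟶ Y) (g : Y ⟶ Z), (c • f) ≫ g = c • (f ≫ g)
  comp_smul : ∀ {X Y Z : 𝒞} (f : X ⟶ Y) (c : ℂ) (g : Y ⟶ Z), f ≫ (c • g) = c • (f ≫ g)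
  norm_comp_le : ∀ {X Y Z : 𝒞} (f : X ⟶ Y) (g : Y ⟶ Z), ‖f ≫ g‖ ≤ ‖g‖ * ‖f‖
  dag : ∀ {X Y : 𝒞}, (X ⟶ Y) → (Y ⟶ X)
  dag_add : ∀ {X Y : 𝒞} (f g : X ⟶ Y), dag (f + g) = dag f + dag g
  dag_smul : ∀ {X Y : 𝒞} (c : ℂ) (f : X ⟶ Y), dag (c • f) = star c • dag f
  dag_dag : ∀ {X Y : 𝒞} (f : X ⟶ Y), dag (dag f) = f
  dag_id : ∀ X : 𝒞, dag (𝟙 X) = 𝟙 X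
  dag_comp : ∀ {X Y Z : 𝒞} (f : X ⟶ Y) (g : Y ⟶ Z), dag (f ≫ g) = dag g ≫ dag f
  norm_comp_dag : ∀ {X Y : 𝒞} (f : X ⟶ Y), ‖f ≫ dag f‖ = ‖f‖ ^ 2
  id_ne_zero : ∀ X : 𝒞, 𝟙 X ≠ 0

attribute [reducible] CStarCategory.homNormed CStarCategory.homSpace

attribute [instance] CStarCategory.homNormed CStarCategory.homSpace CStarCategory.homComplete

open CStarCategory

section Category

variable {𝒞 : Type u} [Category.{v} 𝒞] [CStarCategory 𝒞]

instance : Preadditive 𝒞 where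
  homGroup _ _ := inferInstance
  add_comp _ _ _ f f' g := CStarCategory.add_comp f f' g
  comp_add _ _ _ f g g' := CStarCategory.comp_add f g g'

instance : Linear ℂ 𝒞 where
  homModule _ _ := inferInstance
  smul_comp _ _ _ c f g := CStarCategory.smul_comp c f g
  comp_smul _ _ _ f c g := CStarCategory.comp_smul f c g

/-- The `*`-algebra structure on `(X, X) = End X`; the product is `a * b = a ∘ b = b ≫ a`. -/
instance (X : 𝒞) : StarRing (End X) where
  star f := (dag (f : X ⟶ X) : X ⟶ X)
  star_involutive f := dag_dag (f : X ⟶ X)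
  star_mul f g := dag_comp (g : X ⟶ X) (f : X ⟶ X)
  star_add f g := dag_add (f : X ⟶ X) (g : X ⟶ X)

instance (X : 𝒞) : StarModule ℂ (End X) where
  star_smul c f := dag_smul c (f : X ⟶ X)

/-- `V* ∘ V = 1`. -/
def IsIsometry {X Y : 𝒞} (V : X ⟶ Y) : Prop := V ≫ dag V = 𝟙 X

/-- `X` and `Y` are (unitarily) equivalent. -/
def Equivalent (X Y : 𝒞) : Prop := ∃ U : X ⟶ Y, U ≫ dag U = 𝟙 X ∧ dag U ≫ U = 𝟙 Y

/-- `X` is irreducible: `(X, X) = ℂ 1`. -/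
def IsIrreducible (X : 𝒞) : Prop := ∀ T : X ⟶ X, ∃ c : ℂ, T = c • 𝟙 X

/-- `V` exhibits its source as a subobject of `X` corresponding to `E`: `V* ∘ V = 1`, and
`V ∘ V* = E`. -/
def IsSubobjectFor {Y X : 𝒞} (V : Y ⟶ X) (E : End X) : Prop :=
  IsIsometry V ∧ dag V ≫ V = E

/-- `Y ≤ X`: `Y` is a subobject of `X`. -/
def IsSubobject (Y X : 𝒞) : Prop := ∃ (E : End X) (V : Y ⟶ X), IsSubobjectFor V E

end Category

/-! ### C*-tensor categories -/

/-- A `C*`-category with a monoidal structure is a `C*`-tensor category if the tensor product of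
morphisms is bilinear and compatible with the involution, and the associators and unitors are
unitary. -/
class CStarTensorCategory (𝒞 : Type u) [Category.{v} 𝒞] [MonoidalCategory 𝒞]
    [CStarCategory 𝒞] : Prop where
  add_tensor : ∀ {X Y X' Y' : 𝒞} (f g : X ⟶ Y) (h : X' ⟶ Y'), (f + g) ⊗ₘ h = f ⊗ₘ h + g ⊗ₘ h
  tensor_add : ∀ {X Y X' Y' : 𝒞} (f : X ⟶ Y) (g h : X' ⟶ Y'), f ⊗ₘ (g + h) = f ⊗ₘ g + f ⊗ₘ h
  smul_tensor : ∀ {X Y X' Y' : 𝒞} (c : ℂ) (f : X ⟶ Y) (g : X' ⟶ Y'),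
    (c • f) ⊗ₘ g = c • (f ⊗ₘ g)
  tensor_smul : ∀ {X Y X' Y' : 𝒞} (f : X ⟶ Y) (c : ℂ) (g : X' ⟶ Y'),
    f ⊗ₘ (c • g) = c • (f ⊗ₘ g)
  dag_tensor : ∀ {X Y X' Y' : 𝒞} (f : X ⟶ Y) (g : X' ⟶ Y'), dag (f ⊗ₘ g) = dag f ⊗ₘ dag g
  dag_associator : ∀ X Y Z : 𝒞, dag (α_ X Y Z).hom = (α_ X Y Z).inv
  dag_leftUnitor : ∀ X : 𝒞, dag (λ_ X).hom = (λ_ X).inv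
  dag_rightUnitor : ∀ X : 𝒞, dag (ρ_ X).hom = (ρ_ X).inv

open CStarTensorCategory

section Tensor

variable {𝒞 : Type u} [Category.{v} 𝒞] [MonoidalCategory 𝒞] [CStarCategory 𝒞]

/-- `(R, R')` is a pair of conjugation operators for `X` and `X'`. -/
def IsConjugationPair (X X' : 𝒞) (R : 𝟙_ 𝒞 ⟶ X' ⊗ X) (R' : 𝟙_ 𝒞 ⟶ X ⊗ X') : Prop :=
  (ρ_ X).inv ≫ X ◁ R ≫ (α_ X X' X).inv ≫ dag R' ▷ X ≫ (λ_ X).hom = 𝟙 X ∧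
  (ρ_ X').inv ≫ X' ◁ R' ≫ (α_ X' X X').inv ≫ dag R ▷ X' ≫ (λ_ X').hom = 𝟙 X'

/-- A standard pair of conjugation operators for an irreducible object:
`R* ∘ R = R'* ∘ R'`. -/
def IsIrredStandardPair (X X' : 𝒞) (R : 𝟙_ 𝒞 ⟶ X' ⊗ X) (R' : 𝟙_ 𝒞 ⟶ X ⊗ X') : Prop :=
  IsIrreducible X ∧ IsConjugationPair X X' R R' ∧ R ≫ dag R = R' ≫ dag R'

/-- A standard pair of conjugation operators for an arbitrary object: one that is assembled from
standard pairs of irreducible objects along orthogonal decompositions of `X` and `X'`. -/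
def IsStandardPair (X X' : 𝒞) (R : 𝟙_ 𝒞 ⟶ X' ⊗ X) (R' : 𝟙_ 𝒞 ⟶ X ⊗ X') : Prop :=
  ∃ (n : ℕ) (Y Y' : Fin n → 𝒞) (W : ∀ i, Y i ⟶ X) (W' : ∀ i, Y' i ⟶ X')
    (S : ∀ i, 𝟙_ 𝒞 ⟶ Y' i ⊗ Y i) (S' : ∀ i, 𝟙_ 𝒞 ⟶ Y i ⊗ Y' i),
    (∀ i, IsIrredStandardPair (Y i) (Y' i) (S i) (S' i)) ∧
    (∀ i, IsIsometry (W i)) ∧ (∀ i, IsIsometry (W' i)) ∧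
    ∑ i, dag (W i) ≫ W i = 𝟙 X ∧ ∑ i, dag (W' i) ≫ W' i = 𝟙 X' ∧
    R = ∑ i, S i ≫ (W' i ⊗ₘ W i) ∧ R' = ∑ i, S' i ≫ (W i ⊗ₘ W' i)

open Classical in
/-- The statistical dimension `d(X)`: the number `R* ∘ R` for a standard pair `(R, R')`
for `X` and a conjugate `X'` of `X`. -/
def statDim (X : 𝒞) : ℝ :=
  if h : ∃ (d : ℝ) (X' : 𝒞) (R : 𝟙_ 𝒞 ⟶ X' ⊗ X) (R' : 𝟙_ 𝒞 ⟶ X ⊗ X'),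
      IsStandardPair X X' R R' ∧ R ≫ dag R = (d : ℂ) • 𝟙 (𝟙_ 𝒞)
  then h.choose else 0

variable (𝒞) in
/-- A finite `C*`-tensor category: it has subobjects and direct sums, the unit object is
irreducible, every object has a conjugate, and there are only finitely many equivalence classes
of irreducible objects. As there are no zero objects, only nonzero projections have subobjects. -/
structure IsFiniteCStarTensorCategory : Prop where
  subobjects : ∀ (X : 𝒞) (E : End X), IsStarProjection E → E ≠ 0 →
    ∃ (Y : 𝒞) (V : Y ⟶ X), IsSubobjectFor V E
  directSums : ∀ X Y : 𝒞, ∃ (Z : 𝒞) (V : X ⟶ Z) (W : Y ⟶ Z),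
    IsIsometry V ∧ IsIsometry W ∧ dag V ≫ V + dag W ≫ W = 𝟙 Z
  unit_irreducible : IsIrreducible (𝟙_ 𝒞)
  conjugates : ∀ X : 𝒞, ∃ (X' : 𝒞) (R : 𝟙_ 𝒞 ⟶ X' ⊗ X) (R' : 𝟙_ 𝒞 ⟶ X ⊗ X'),
    IsConjugationPair X X' R R'
  finite_irreducibles : ∃ s : Set 𝒞, s.Finite ∧
    ∀ X : 𝒞, IsIrreducible X → ∃ Y ∈ s, Equivalent X Y

/-- A minimal projection of `(X, X)`. -/
def IsMinimalProjection {X : 𝒞} (E : End X) : Prop :=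
  IsStarProjection E ∧ E ≠ 0 ∧ ∀ T : End X, ∃ c : ℂ, E * T * E = c • E

/-- `t` is a trace on `(X, X)` with `t(E) = d(Y) / d(X)` whenever `E` is a minimal projection and
`Y` is a subobject of `X` corresponding to `E`. -/
def IsCatTrace (X : 𝒞) (t : End X →ₗ[ℂ] ℂ) : Prop :=
  (∀ S T : End X, t (S * T) = t (T * S)) ∧
  ∀ (E : End X) (Y : 𝒞) (V : Y ⟶ X), IsMinimalProjection E → IsSubobjectFor V E →
    t E = ((statDim Y / statDim X : ℝ) : ℂ)

open Classical in
/-- The distinguished trace `tr_X` on `(X, X)`. -/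
def catTrace (X : 𝒞) : End X →ₗ[ℂ] ℂ :=
  if h : ∃ t : End X →ₗ[ℂ] ℂ, IsCatTrace X t then h.choose else 0

variable [CStarTensorCategory 𝒞]

/-- The `*`-homomorphism `(X, X) → (XY, XY)`, `T ↦ T × 1_Y`. -/
def inclRight (X Y : 𝒞) : End X →⋆ₐ[ℂ] End (X ⊗ Y) where
  toFun T := (((T : X ⟶ X) ⊗ₘ 𝟙 Y : X ⊗ Y ⟶ X ⊗ Y) : End (X ⊗ Y))
  map_one' := id_tensorHom_id X Y
  map_mul' S T := by
    change ((T : X ⟶ X) ≫ (S : X ⟶ X)) ⊗ₘ 𝟙 Y =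
      ((T : X ⟶ X) ⊗ₘ 𝟙 Y) ≫ ((S : X ⟶ X) ⊗ₘ 𝟙 Y)
    simp
  map_zero' := by
    have h := smul_tensor (0 : ℂ) (0 : X ⟶ X) (𝟙 Y)
    rw [zero_smul, zero_smul] at h
    exact h
  map_add' S T := add_tensor (S : X ⟶ X) (T : X ⟶ X) (𝟙 Y)
  commutes' c := by
    change (c • 𝟙 X) ⊗ₘ 𝟙 Y = c • 𝟙 (X ⊗ Y)
    rw [smul_tensor, id_tensorHom_id]
  map_star' T := by
    change (dag (T : X ⟶ X)) ⊗ₘ 𝟙 Y = dag ((T : X ⟶ X) ⊗ₘ 𝟙 Y)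
    rw [dag_tensor, dag_id]

/-- The `*`-homomorphism `(X, X) → (YX, YX)`, `T ↦ 1_Y × T`. -/
def inclLeft (Y X : 𝒞) : End X →⋆ₐ[ℂ] End (Y ⊗ X) where
  toFun T := ((𝟙 Y ⊗ₘ (T : X ⟶ X) : Y ⊗ X ⟶ Y ⊗ X) : End (Y ⊗ X))
  map_one' := id_tensorHom_id Y X
  map_mul' S T := by
    change 𝟙 Y ⊗ₘ ((T : X ⟶ X) ≫ (S : X ⟶ X)) =
      (𝟙 Y ⊗ₘ (T : X ⟶ X)) ≫ (𝟙 Y ⊗ₘ (S : X ⟶ X))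
    simp
  map_zero' := by
    have h := tensor_smul (𝟙 Y) (0 : ℂ) (0 : X ⟶ X)
    rw [zero_smul, zero_smul] at h
    exact h
  map_add' S T := tensor_add (𝟙 Y) (S : X ⟶ X) (T : X ⟶ X)
  commutes' c := by
    change 𝟙 Y ⊗ₘ (c • 𝟙 X) = c • 𝟙 (Y ⊗ X)
    rw [tensor_smul, id_tensorHom_id]
  map_star' T := by
    change 𝟙 Y ⊗ₘ (dag (T : X ⟶ X)) = dag (𝟙 Y ⊗ₘ (T : X ⟶ X))
    rw [dag_tensor, dag_id]

/-- `d(Y)⁻¹ · 1_X × (R' ∘ R'*)` in `(XYY', XYY')`, for `R'` in `(ι, YY')`. -/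
def projRight (X Y Y' : 𝒞) (R' : 𝟙_ 𝒞 ⟶ Y ⊗ Y') : End ((X ⊗ Y) ⊗ Y') :=
  ((statDim Y : ℂ)⁻¹ •
    ((α_ X Y Y').hom ≫ (𝟙 X ⊗ₘ (dag R' ≫ R')) ≫ (α_ X Y Y').inv) :
      (X ⊗ Y) ⊗ Y' ⟶ (X ⊗ Y) ⊗ Y')

/-- `d(Y)⁻¹ · (R ∘ R*) × 1_X` in `(Y'YX, Y'YX)`, for `R` in `(ι, Y'Y)`. -/
def projLeft (X Y Y' : 𝒞) (R : 𝟙_ 𝒞 ⟶ Y' ⊗ Y) : End (Y' ⊗ (Y ⊗ X)) :=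
  ((statDim Y : ℂ)⁻¹ •
    ((α_ Y' Y X).inv ≫ ((dag R ≫ R) ⊗ₘ 𝟙 X) ≫ (α_ Y' Y X).hom) :
      Y' ⊗ (Y ⊗ X) ⟶ Y' ⊗ (Y ⊗ X))

end Tensor

/-! ### The basic construction for finite dimensional algebras -/

section BasicConstruction

/-- A faithful normalized (positive) trace on a complex `*`-algebra. -/
structure FaithfulTrace (B : Type w) [Ring B] [StarRing B] [Algebra ℂ B] where
  toLinearMap : B →ₗ[ℂ] ℂ
  trace_mul_comm : ∀ x y, toLinearMap (x * y) = toLinearMap (y * x)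
  re_nonneg : ∀ x, 0 ≤ (toLinearMap (star x * x)).re
  trace_star : ∀ x, toLinearMap (star x) = star (toLinearMap x)
  faithful : ∀ x, toLinearMap (star x * x) = 0 → x = 0
  trace_one : toLinearMap 1 = 1

variable {B : Type w} [Ring B] [StarRing B] [Algebra ℂ B] [StarModule ℂ B]

/-- `L²(B)` for finite dimensional `B` (no completion is needed): the space `B` with the inner
product `⟪x, y⟫ = tr (x* y)`, conjugate linear in `x`. -/
def L2 (_t : FaithfulTrace B) : Type w := B

namespace L2

variable (t : FaithfulTrace B)

instance : AddCommGroup (L2 t) := inferInstanceAs (AddCommGroup B)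

instance : Module ℂ (L2 t) := inferInstanceAs (Module ℂ B)

instance [FiniteDimensional ℂ B] : FiniteDimensional ℂ (L2 t) :=
  inferInstanceAs (FiniteDimensional ℂ B)

/-- The inner product. -/
abbrev core : InnerProductSpace.Core ℂ (L2 t) where
  inner := fun (x y : B) => t.toLinearMap (star x * y)
  conj_inner_symm := fun (x y : B) => by
    have h := t.trace_star (star y * x)
    rw [star_mul, star_star] at h
    exact h.symm
  re_inner_nonneg := fun (x : B) => t.re_nonneg x
  add_left := fun (x y z : B) => by
    change t.toLinearMap (star (x + y) * z) = _
    rw [star_add, add_mul, map_add]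
  smul_left := fun (x y : B) (r : ℂ) => by
    change t.toLinearMap (star (r • x) * y) = _
    rw [star_smul, smul_mul_assoc, map_smul]
    rfl
  definite := fun (x : B) h => t.faithful x h

instance : NormedAddCommGroup (L2 t) := (core t).toNormedAddCommGroup

instance : InnerProductSpace ℂ (L2 t) := InnerProductSpace.ofCore (core t).toCore

instance [FiniteDimensional ℂ B] : CompleteSpace (L2 t) := FiniteDimensional.complete ℂ (L2 t)

/-- The identity map, from `B` to `L²(B)`. -/
def of : B ≃ₗ[ℂ] L2 t := LinearEquiv.refl ℂ B

end L2

variable [FiniteDimensional ℂ B]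

/-- Left multiplication by `b` on `L²(B)`. -/
def leftMul (t : FaithfulTrace B) (b : B) : L2 t →L[ℂ] L2 t :=
  LinearMap.toContinuousLinearMap ((L2.of t).conj (LinearMap.mulLeft ℂ b))

/-- `L²(A)` as a subspace of `L²(B)`. -/
def subspaceL2 (A : StarSubalgebra ℂ B) (t : FaithfulTrace B) : Submodule ℂ (L2 t) :=
  (Subalgebra.toSubmodule A.toSubalgebra).map (L2.of t : B →ₗ[ℂ] L2 t)

/-- The Jones projection: the orthogonal projection of `L²(B)` onto `L²(A)`. -/
def jonesProj (A : StarSubalgebra ℂ B) (t : FaithfulTrace B) : L2 t →L[ℂ] L2 t :=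
  (subspaceL2 A t).starProjection

/-- The basic construction for `A ⊆ B` and the trace `t`: the `*`-algebra of operators on `L²(B)`
generated by `B` (acting by left multiplication) and the Jones projection. As `L²(B)` is finite
dimensional, this is also the von Neumann algebra that they generate. -/
def basicConstruction (A : StarSubalgebra ℂ B) (t : FaithfulTrace B) :
    StarSubalgebra ℂ (L2 t →L[ℂ] L2 t) :=
  StarAlgebra.adjoin ℂ (Set.range (leftMul t) ∪ {jonesProj A t})

/-- An element `b` of `B` as an element of the basic construction. -/
def basicConstruction.of (A : StarSubalgebra ℂ B) (t : FaithfulTrace B) (b : B) :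
    basicConstruction A t :=
  ⟨leftMul t b, StarAlgebra.subset_adjoin ℂ _ (Or.inl ⟨b, rfl⟩)⟩

/-- The Jones projection as an element of the basic construction. -/
def basicConstruction.jones (A : StarSubalgebra ℂ B) (t : FaithfulTrace B) :
    basicConstruction A t :=
  ⟨jonesProj A t, StarAlgebra.subset_adjoin ℂ _ (Or.inr rfl)⟩

end BasicConstruction

/-- `span B f B` inside an algebra `M` containing `B` through `j`. -/
def spanBfB {B : Type*} {M : Type*} [Ring B] [StarRing B] [Algebra ℂ B] [Ring M] [StarRing M]
    [Algebra ℂ M] (j : B →⋆ₐ[ℂ] M) (f : M) : Submodule ℂ M :=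
  Submodule.span ℂ {x | ∃ b₁ b₂ : B, x = j b₁ * f * j b₂}

end CStarTC

end

open CStarTC

/-!
The proof has a categorical part, which reduces both cases of the theorem to one abstract
situation, and an algebraic part, which treats that situation.

**The canonical trace.** Morphism spaces are finite dimensional (`finiteDimensional_hom`): by
Frobenius reciprocity it is enough to consider `(ι, K)`, and there orthonormal families have
bounded length. So every object has a decomposition into irreducible objects
(`exists_decomposition`), and weighting the diagonal coefficients by the dimensions of the
irreducible summands gives a faithful trace `canTrace` on `(X, X)`, which does not depend on the
decomposition and is cyclic for morphisms between different objects (`canTrace_comm`). A standard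
pair computes it from the left and from the right (`IsStandardPair.canTrace_left`,
`IsStandardPair.canTrace_right`), which identifies `statDim` and `catTrace` (`statDim_eq`,
`catTrace_apply`). Positivity is used throughout; `comp_dag_eq_normSq` derives it from the
existence of direct sums.

**Partial traces.** The main categorical point is that the trace of `XY` is the trace of `X` after
a partial trace over `Y`, and likewise with the roles exchanged (`canTrace_tensor`). The product of
two standard pairs is a pair of conjugation operators whose left and right functionals agree, since
a closed diagram may be contracted in either order (`partialTrace_comm`), and a pair with this
property computes the canonical trace (`IsConjugationPair.eq_canTrace`). It follows that `statDim`
is multiplicative.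

**The basic construction.** Put `v = 1_ρ × R'` (or `R × 1_ρ`). Frobenius reciprocity makes
`b ↦ (b × 1) v` a bijection of `B` onto `(ρ, ρσσ')`, and the partial trace formula turns the inner
product of `L²(B)` into that of `(ρ, ρσσ')`. So `C` acts on `L²(B)` by composition
(`IsFrobeniusInclusion.rep`); here `B` acts by left multiplication and `f = v v* / d(σ)` acts as the
Jones projection. As `C f B ⊆ B f`, the space `D` is an ideal. The action is faithful on `D`, whose
unit acts as the identity, so `D` is mapped onto the basic construction
(`IsFrobeniusInclusion.exists_iso`), and `α` is the inverse of this map. If all irreducible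
subobjects of `ρσσ'` occur in `ρ`, then `(ρ, ρσσ')` generates `ρσσ'`, and the unit of `D` is `1`
(`IsFrobeniusInclusion.spanBfB_eq_top`). The Markov relation is cyclicity of the trace together
with the partial trace formula (`IsFrobeniusInclusion.markov`).
-/

noncomputable section

namespace CStarTC

open CStarCategory CStarTensorCategory

/-! ### The involution, scalars and positivity -/

section Category

variable {𝒞 : Type u} [Category.{v} 𝒞] [CStarCategory 𝒞]

attribute [simp] dag_dag dag_id

lemma dag_injective {X Y : 𝒞} : Function.Injective (dag : (X ⟶ Y) → (Y ⟶ X)) :=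
  Function.LeftInverse.injective dag_dag

/-- The involution as an additive homomorphism. -/
def dagHom (X Y : 𝒞) : (X ⟶ Y) →+ (Y ⟶ X) := AddMonoidHom.mk' dag dag_add

@[simp] lemma dag_zero {X Y : 𝒞} : dag (0 : X ⟶ Y) = 0 := (dagHom X Y).map_zero

lemma dag_sub {X Y : 𝒞} (f g : X ⟶ Y) : dag (f - g) = dag f - dag g := (dagHom X Y).map_sub f g

lemma dag_sum {X Y : 𝒞} {ι : Type*} (s : Finset ι) (f : ι → (X ⟶ Y)) :
    dag (∑ i ∈ s, f i) = ∑ i ∈ s, dag (f i) := map_sum (dagHom X Y) f s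

lemma eq_zero_of_comp_dag {X Y : 𝒞} {f : X ⟶ Y} (h : f ≫ dag f = 0) : f = 0 := by
  have h1 := norm_comp_dag f
  rw [h, norm_zero] at h1
  exact norm_eq_zero.1 (pow_eq_zero_iff two_ne_zero |>.1 h1.symm)

lemma eq_zero_of_dag_comp {X Y : 𝒞} {f : X ⟶ Y} (h : dag f ≫ f = 0) : f = 0 := by
  have h1 : dag f = 0 := eq_zero_of_comp_dag (by rw [dag_dag, h])
  rw [← dag_dag f, h1, dag_zero]

lemma norm_dag_le {X Y : 𝒞} (f : X ⟶ Y) : ‖f‖ ≤ ‖dag f‖ := by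
  rcases (norm_nonneg f).eq_or_lt with h | h
  · rw [← h]; exact norm_nonneg _
  · have h1 := norm_comp_le f (dag f)
    rw [norm_comp_dag, sq] at h1
    exact le_of_mul_le_mul_right h1 h

lemma norm_dag {X Y : 𝒞} (f : X ⟶ Y) : ‖dag f‖ = ‖f‖ :=
  le_antisymm (by simpa using norm_dag_le (dag f)) (norm_dag_le f)

lemma norm_le_one_of_projection {X : 𝒞} {E : X ⟶ X} (h1 : dag E = E) (h2 : E ≫ E = E) :
    ‖E‖ ≤ 1 := by
  have h := norm_comp_dag E
  rw [h1, h2, sq] at h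
  nlinarith [norm_nonneg E]

lemma norm_id (X : 𝒞) : ‖𝟙 X‖ = 1 := by
  have h := norm_comp_dag (𝟙 X)
  rw [dag_id, Category.comp_id, sq] at h
  have h0 : ‖𝟙 X‖ ≠ 0 := norm_ne_zero_iff.2 (id_ne_zero X)
  exact (mul_right_cancel₀ h0 (by rw [one_mul]; exact h)).symm

lemma norm_le_one_of_isIsometry {X Y : 𝒞} {V : X ⟶ Y} (h : IsIsometry V) : ‖V‖ ≤ 1 := by
  have h1 := norm_comp_dag V
  rw [show V ≫ dag V = 𝟙 X from h, norm_id] at h1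
  nlinarith [norm_nonneg V]

lemma smul_id_injective (X : 𝒞) : Function.Injective (fun c : ℂ => c • 𝟙 X) :=
  smul_left_injective ℂ (id_ne_zero X)

lemma IsIsometry.ne_zero {X Y : 𝒞} {V : X ⟶ Y} (h : IsIsometry V) : V ≠ 0 := by
  rintro rfl
  exact id_ne_zero X (by rw [← h, Limits.zero_comp])

/-- The scalar `c` of an endomorphism `c • 𝟙 Y` of an irreducible object, as a linear
functional. -/
def IsIrreducible.coeff {Y : 𝒞} (hY : IsIrreducible Y) : (Y ⟶ Y) →ₗ[ℂ] ℂ where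
  toFun T := (hY T).choose
  map_add' S T := smul_id_injective Y (by
    change (hY (S + T)).choose • 𝟙 Y = ((hY S).choose + (hY T).choose) • 𝟙 Y
    rw [add_smul, ← (hY S).choose_spec, ← (hY T).choose_spec, ← (hY (S + T)).choose_spec])
  map_smul' c T := smul_id_injective Y (by
    change (hY (c • T)).choose • 𝟙 Y = (c • (hY T).choose) • 𝟙 Y
    rw [smul_assoc, ← (hY T).choose_spec, ← (hY (c • T)).choose_spec])

lemma IsIrreducible.coeff_smul {Y : 𝒞} (hY : IsIrreducible Y) (T : Y ⟶ Y) :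
    hY.coeff T • 𝟙 Y = T := (hY T).choose_spec.symm

lemma IsIrreducible.coeff_eq {Y : 𝒞} (hY : IsIrreducible Y) {T : Y ⟶ Y} {c : ℂ}
    (h : T = c • 𝟙 Y) : hY.coeff T = c :=
  smul_id_injective Y (by simpa [hY.coeff_smul] using h)

lemma IsIrreducible.coeff_id {Y : 𝒞} (hY : IsIrreducible Y) : hY.coeff (𝟙 Y) = 1 :=
  hY.coeff_eq (one_smul ℂ _).symm

lemma IsIrreducible.coeff_dag {Y : 𝒞} (hY : IsIrreducible Y) (T : Y ⟶ Y) :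
    hY.coeff (dag T) = star (hY.coeff T) :=
  hY.coeff_eq (by conv_lhs => rw [← hY.coeff_smul T, dag_smul, dag_id])

end Category

section Tensor

variable {𝒞 : Type u} [Category.{v} 𝒞] [MonoidalCategory 𝒞] [CStarCategory 𝒞]

/-- Positivity of `f* ∘ f` when it is a scalar. The axioms of a `C*`-category alone do not give
the sign (the involution could be twisted by signs depending on the objects); it comes from
direct sums, through the `C*`-identity for a column with entries `1` and `f`. -/
lemma comp_dag_eq_normSq (h𝒞 : IsFiniteCStarTensorCategory 𝒞) {X Y : 𝒞} {f : X ⟶ Y} {c : ℂ}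
    (h : f ≫ dag f = c • 𝟙 X) : c = ((‖f‖ ^ 2 : ℝ) : ℂ) := by
  have hc : star c = c := smul_id_injective X (by
    have h1 := congrArg dag h
    rw [dag_comp, dag_dag, h, dag_smul, dag_id] at h1
    exact h1.symm)
  obtain ⟨r, rfl⟩ : ∃ r : ℝ, c = (r : ℂ) := ⟨c.re, (Complex.conj_eq_iff_re.1 hc).symm⟩
  have hn : |r| = ‖f‖ ^ 2 := by
    rw [← norm_comp_dag, h, norm_smul, norm_id, mul_one, Complex.norm_real, Real.norm_eq_abs]
  rcases le_or_gt 0 r with hr | hr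
  · rw [← hn, abs_of_nonneg hr]
  exfalso
  obtain ⟨Z, V, W, hV, hW, hVW⟩ := h𝒞.directSums X Y
  have hWV : W ≫ dag V = 0 := by
    have h1 : W ≫ (dag V ≫ V + dag W ≫ W) = W := by rw [hVW, Category.comp_id]
    rw [Preadditive.comp_add, ← Category.assoc W (dag W), hW, Category.id_comp,
      add_eq_right] at h1
    have h2 := congrArg (· ≫ dag V) h1
    simp only [Category.assoc, Limits.zero_comp] at h2
    rwa [hV, Category.comp_id] at h2
  have hVW' : V ≫ dag W = 0 := by
    rw [← dag_dag V, ← dag_comp, hWV, dag_zero]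
  have hs : (0 : ℝ) < √(-r) := Real.sqrt_pos.2 (by linarith)
  -- the column `(√(-r), f)` has norm zero
  have hg : (((√(-r) : ℝ) : ℂ) • V + f ≫ W) = 0 := by
    apply eq_zero_of_comp_dag
    rw [dag_add, dag_smul, dag_comp]
    simp only [Preadditive.add_comp, Preadditive.comp_add, Linear.smul_comp, Linear.comp_smul,
      Category.assoc]
    rw [hV, reassoc_of% hVW', hWV, reassoc_of% (show W ≫ dag W = 𝟙 Y from hW), h]
    simp only [Limits.zero_comp, Limits.comp_zero, smul_zero, add_zero, zero_add,
      smul_smul, ← add_smul]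
    rw [Complex.star_def, Complex.conj_ofReal, ← Complex.ofReal_mul,
      Real.mul_self_sqrt (by linarith)]
    simp
  have h3 := congrArg (· ≫ dag V) hg
  simp only [Preadditive.add_comp, Linear.smul_comp, Category.assoc, hWV, Limits.comp_zero,
    add_zero, Limits.zero_comp] at h3
  rw [show V ≫ dag V = 𝟙 X from hV, smul_eq_zero] at h3
  rcases h3 with h3 | h3
  · exact hs.ne' (by exact_mod_cast h3)
  · exact id_ne_zero X h3

lemma comp_dag_unit (h𝒞 : IsFiniteCStarTensorCategory 𝒞) {K : 𝒞} (f : 𝟙_ 𝒞 ⟶ K) :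
    f ≫ dag f = ((‖f‖ ^ 2 : ℝ) : ℂ) • 𝟙 (𝟙_ 𝒞) := by
  obtain ⟨c, hc⟩ := h𝒞.unit_irreducible (f ≫ dag f)
  rw [hc, comp_dag_eq_normSq h𝒞 hc]

lemma IsIrreducible.coeff_comp_dag (h𝒞 : IsFiniteCStarTensorCategory 𝒞) {Y Z : 𝒞}
    (hY : IsIrreducible Y) (f : Y ⟶ Z) : hY.coeff (f ≫ dag f) = ((‖f‖ ^ 2 : ℝ) : ℂ) :=
  comp_dag_eq_normSq h𝒞 (hY.coeff_smul _).symm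

variable [CStarTensorCategory 𝒞]

instance : MonoidalPreadditive 𝒞 where
  whiskerLeft_zero {X Y Z} := by
    have h := tensor_smul (𝟙 X) (0 : ℂ) (0 : Y ⟶ Z)
    rw [zero_smul, zero_smul] at h
    rw [← id_tensorHom]; exact h
  zero_whiskerRight {X Y Z} := by
    have h := smul_tensor (0 : ℂ) (0 : Y ⟶ Z) (𝟙 X)
    rw [zero_smul, zero_smul] at h
    rw [← tensorHom_id]; exact h
  whiskerLeft_add f g := by simp only [← id_tensorHom]; exact tensor_add _ f g
  add_whiskerRight f g := by simp only [← tensorHom_id]; exact add_tensor f g _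

instance : MonoidalLinear ℂ 𝒞 where
  whiskerLeft_smul X Y Z c f := by simp only [← id_tensorHom]; exact tensor_smul _ c f
  smul_whiskerRight c Y Z f X := by simp only [← tensorHom_id]; exact smul_tensor c f _

@[simp] lemma dag_whiskerLeft (X : 𝒞) {Y Z : 𝒞} (f : Y ⟶ Z) : dag (X ◁ f) = X ◁ dag f := by
  simp only [← id_tensorHom, dag_tensor, dag_id]

@[simp] lemma dag_whiskerRight {Y Z : 𝒞} (f : Y ⟶ Z) (X : 𝒞) : dag (f ▷ X) = dag f ▷ X := by
  simp only [← tensorHom_id, dag_tensor, dag_id]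

attribute [simp] dag_associator dag_leftUnitor dag_rightUnitor

@[simp] lemma dag_associator_inv (X Y Z : 𝒞) : dag (α_ X Y Z).inv = (α_ X Y Z).hom := by
  rw [← dag_associator, dag_dag]

@[simp] lemma dag_leftUnitor_inv (X : 𝒞) : dag (λ_ X).inv = (λ_ X).hom := by
  rw [← dag_leftUnitor, dag_dag]

@[simp] lemma dag_rightUnitor_inv (X : 𝒞) : dag (ρ_ X).inv = (ρ_ X).hom := by
  rw [← dag_rightUnitor, dag_dag]

end Tensor

/-! ### Conjugation pairs and Frobenius reciprocity -/

section Conjugation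

variable {𝒞 : Type u} [Category.{v} 𝒞] [MonoidalCategory 𝒞] [CStarCategory 𝒞]
  {X X' : 𝒞} {R : 𝟙_ 𝒞 ⟶ X' ⊗ X} {R' : 𝟙_ 𝒞 ⟶ X ⊗ X'}

lemma IsConjugationPair.symm (h : IsConjugationPair X X' R R') :
    IsConjugationPair X' X R' R := ⟨h.2, h.1⟩

variable [CStarTensorCategory 𝒞]

/-- A pair of conjugation operators is an exact pairing whose evaluation is the adjoint of the
other operator; here `R'` is the coevaluation. -/
@[reducible] def IsConjugationPair.exactPairing (h : IsConjugationPair X X' R R') :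
    ExactPairing X X' where
  coevaluation' := R'
  evaluation' := dag R
  coevaluation_evaluation' := by
    rw [← Category.comp_id ((ρ_ X').hom ≫ (λ_ X').inv), ← cancel_epi (ρ_ X').inv,
      ← cancel_mono (λ_ X').hom]
    simpa using h.2
  evaluation_coevaluation' := by
    have h1 := congrArg dag h.1
    simp only [dag_comp, dag_rightUnitor_inv, dag_whiskerLeft, dag_associator_inv,
      dag_whiskerRight, dag_dag, dag_leftUnitor, dag_id, Category.assoc] at h1
    rw [← cancel_epi (λ_ X).inv, ← cancel_mono (ρ_ X).hom]
    simpa using h1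

lemma isConjugationPair_of_exactPairing [ExactPairing X X'] (h1 : η_ X X' = R')
    (h2 : ε_ X X' = dag R) : IsConjugationPair X X' R R' := by
  have e1 := ExactPairing.coevaluation_evaluation X X'
  have e2 := ExactPairing.evaluation_coevaluation X X'
  rw [h1, h2] at e1 e2
  constructor
  · apply dag_injective
    simp only [dag_comp, dag_rightUnitor_inv, dag_whiskerLeft, dag_associator_inv,
      dag_whiskerRight, dag_dag, dag_leftUnitor, dag_id, Category.assoc]
    rw [reassoc_of% e2]
    simp
  · rw [reassoc_of% e1]
    simp

/-- Bending the leg `X'` of `K ∈ (ι, X' Y)`, which gives an element of `(X, Y)`. -/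
def bend (R' : 𝟙_ 𝒞 ⟶ X ⊗ X') {Y : 𝒞} (K : 𝟙_ 𝒞 ⟶ X' ⊗ Y) : X ⟶ Y :=
  (ρ_ X).inv ≫ X ◁ K ≫ (α_ X X' Y).inv ≫ dag R' ▷ Y ≫ (λ_ Y).hom

lemma bend_eq (h : IsConjugationPair X X' R R') {Y : 𝒞} (K : 𝟙_ 𝒞 ⟶ X' ⊗ Y) :
    let := h.symm.exactPairing
    bend R' K = (ρ_ X).inv ≫ (tensorLeftHomEquiv (𝟙_ 𝒞) X' X Y).symm K := rfl

lemma bend_comp_whiskerLeft (h : IsConjugationPair X X' R R') {Y : 𝒞} (t : X ⟶ Y) :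
    bend R' (R ≫ X' ◁ t) = t := by
  let := h.symm.exactPairing
  rw [bend_eq h]
  erw [tensorLeftHomEquiv_symm_coevaluation_comp_whiskerLeft t]
  simp

lemma bend_injective (h : IsConjugationPair X X' R R') {Y : 𝒞} :
    Function.Injective (bend R' : (𝟙_ 𝒞 ⟶ X' ⊗ Y) → (X ⟶ Y)) := by
  let := h.symm.exactPairing
  intro K L hKL
  rw [bend_eq h, bend_eq h] at hKL
  exact (tensorLeftHomEquiv (𝟙_ 𝒞) X' X Y).symm.injective ((cancel_epi _).1 hKL)

/-- Frobenius reciprocity `(X, Y) ≅ (ι, X' Y)`. -/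
lemma bijective_comp_whiskerLeft (h : IsConjugationPair X X' R R') (Y : 𝒞) :
    Function.Bijective (fun t : X ⟶ Y => R ≫ X' ◁ t) :=
  ⟨Function.LeftInverse.injective (bend_comp_whiskerLeft h),
    fun K => ⟨bend R' K, bend_injective h (bend_comp_whiskerLeft h _)⟩⟩

/-- Frobenius reciprocity `(X', Y) ≅ (ι, Y X)`. -/
lemma bijective_comp_whiskerRight (h : IsConjugationPair X X' R R') (Y : 𝒞) :
    Function.Bijective (fun t : X' ⟶ Y => R ≫ t ▷ X) := by
  let := h.symm.exactPairing
  have key : (fun t : X' ⟶ Y => R ≫ t ▷ X) = fun t =>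
      tensorRightHomEquiv (𝟙_ 𝒞) X' X Y ((λ_ X').hom ≫ t) := by
    funext t
    rw [← Equiv.symm_apply_eq]
    exact tensorRightHomEquiv_symm_coevaluation_comp_whiskerRight t
  rw [key]
  refine (Equiv.bijective _).comp ⟨fun s t hst => (cancel_epi _).1 hst, fun t => ?_⟩
  exact ⟨(λ_ X').inv ≫ t, by simp⟩

/-- Frobenius reciprocity `(ZX, Y) ≅ (Z, YX')`. -/
lemma bijective_frobenius_right (h : IsConjugationPair X X' R R') (Z Y : 𝒞) :
    Function.Bijective (fun t : Z ⊗ X ⟶ Y =>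
      (ρ_ Z).inv ≫ Z ◁ R' ≫ (α_ Z X X').inv ≫ t ▷ X') := by
  let := h.exactPairing
  exact (tensorRightHomEquiv Z X X' Y).bijective

/-- Frobenius reciprocity `(XZ, Y) ≅ (Z, X'Y)`. -/
lemma bijective_frobenius_left (h : IsConjugationPair X X' R R') (Z Y : 𝒞) :
    Function.Bijective (fun t : X ⊗ Z ⟶ Y =>
      (λ_ Z).inv ≫ R ▷ Z ≫ (α_ X' X Z).hom ≫ X' ◁ t) := by
  let := h.symm.exactPairing
  exact (tensorLeftHomEquiv Z X' X Y).bijective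

lemma IsConjugationPair.ne_zero (h : IsConjugationPair X X' R R') : R ≠ 0 := by
  rintro rfl
  have h1 := h.1
  simp at h1
  exact id_ne_zero X h1.symm

/-- The two ways of transporting an endomorphism of `X'` to `X` are related by the involution. -/
lemma transport_dag (h : IsConjugationPair X X' R R') {Y Y' : 𝒞} {S : 𝟙_ 𝒞 ⟶ Y' ⊗ Y}
    {S' : 𝟙_ 𝒞 ⟶ Y ⊗ Y'} (hS : IsConjugationPair Y Y' S S')
    {g : X' ⟶ Y'} {t : Y ⟶ X}
    (hg : R' ≫ X ◁ g = S' ≫ t ▷ Y') : S ≫ dag g ▷ Y = R ≫ X' ◁ dag t := by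
  apply bend_injective h
  rw [bend_comp_whiskerLeft h]
  have h2 := congrArg dag hg
  simp only [dag_comp, dag_whiskerLeft, dag_whiskerRight] at h2
  have h3 := hS.1
  calc bend R' (S ≫ dag g ▷ Y)
      = (ρ_ X).inv ≫ X ◁ S ≫ (α_ X Y' Y).inv ≫ (X ◁ dag g ≫ dag R') ▷ Y ≫ (λ_ Y).hom := by
        simp [bend]
    _ = dag t ≫ (ρ_ Y).inv ≫ Y ◁ S ≫ (α_ Y Y' Y).inv ≫ dag S' ▷ Y ≫ (λ_ Y).hom := by
        rw [h2]
        simp only [comp_whiskerRight, Category.assoc]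
        rw [rightUnitor_inv_naturality_assoc, ← whisker_exchange_assoc,
          ← associator_inv_naturality_left_assoc]
    _ = dag t := by rw [h3, Category.comp_id]

/-- Comparison of two pairs of conjugation operators for the same object: both are obtained from
each other by twisting with endomorphisms `t`, `t'` of `X` that are inverse up to the
involution. -/
lemma exists_comparison (h : IsConjugationPair X X' R R') {X'' : 𝒞} {Q : 𝟙_ 𝒞 ⟶ X'' ⊗ X}
    {Q' : 𝟙_ 𝒞 ⟶ X ⊗ X''} (hQ : IsConjugationPair X X'' Q Q') :
    ∃ t t' : X ⟶ X, dag t' ≫ t = 𝟙 X ∧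
      (∀ T : X ⟶ X, Q ≫ X'' ◁ T ≫ dag Q = R ≫ X' ◁ (t ≫ T) ≫ dag R) ∧
      (∀ T : X ⟶ X, Q' ≫ T ▷ X'' ≫ dag Q' = R' ≫ (t' ≫ T) ▷ X' ≫ dag R') := by
  obtain ⟨U, hU⟩ := (bijective_comp_whiskerRight h X'').2 Q
  obtain ⟨V, hV⟩ := (bijective_comp_whiskerLeft h.symm X'').2 Q'
  obtain ⟨U₂, hU₂⟩ := (bijective_comp_whiskerRight hQ X').2 R
  dsimp only at hU hV hU₂
  -- the first conjugation equation for `(Q, Q')`, rewritten for `(R, R')`, is `V* ∘ U = 1`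
  have e1 : U ≫ dag V = 𝟙 X' := by
    apply (bijective_comp_whiskerRight h X').1
    dsimp only
    apply bend_injective h
    have h1 := hQ.1
    rw [← hU, ← hV] at h1
    have h2 := h.1
    simp only [id_whiskerRight, Category.comp_id]
    rw [show bend R' R = 𝟙 X from h2, ← h1]
    simp only [bend, MonoidalCategory.whiskerLeft_comp, comp_whiskerRight, Category.assoc,
      dag_comp, dag_whiskerLeft]
    simp
  have e2 : U₂ ≫ U = 𝟙 X'' := by
    apply (bijective_comp_whiskerRight hQ X'').1
    simp [hU, reassoc_of% hU₂]
  have e3 : dag V = U₂ := by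
    rw [← Category.id_comp (dag V), ← e2, Category.assoc, e1, Category.comp_id]
  have e4 : dag U ≫ V = 𝟙 X'' := by
    rw [← dag_dag V, ← dag_comp, e3, e2, dag_id]
  obtain ⟨t, ht⟩ := (bijective_comp_whiskerLeft h X).2 (R ≫ (U ≫ dag U) ▷ X)
  obtain ⟨t', ht'⟩ := (bijective_comp_whiskerRight h.symm X).2 (R' ≫ X ◁ (V ≫ dag V))
  dsimp only at ht ht'
  refine ⟨t, t', ?_, fun T => ?_, fun T => ?_⟩
  · have ht'' := transport_dag h h ht'.symm
    rw [dag_comp, dag_dag] at ht''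
    apply (bijective_comp_whiskerLeft h X).1
    calc R ≫ X' ◁ (dag t' ≫ t)
        = R ≫ (V ≫ dag V) ▷ X ≫ X' ◁ t := by
          rw [MonoidalCategory.whiskerLeft_comp, ← Category.assoc, ← ht'', Category.assoc]
      _ = (R ≫ X' ◁ t) ≫ (V ≫ dag V) ▷ X := by
          rw [← whisker_exchange, Category.assoc]
      _ = R ≫ (U ≫ (dag U ≫ V) ≫ dag V) ▷ X := by
          rw [ht]; simp
      _ = R ≫ X' ◁ 𝟙 X := by rw [e4, Category.id_comp, e1]; simp
  · rw [← hU]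
    calc (R ≫ U ▷ X) ≫ X'' ◁ T ≫ dag (R ≫ U ▷ X)
        = (R ≫ (U ≫ dag U) ▷ X) ≫ X' ◁ T ≫ dag R := by
          simp only [dag_comp, dag_whiskerRight, comp_whiskerRight, Category.assoc]
          rw [whisker_exchange_assoc]
      _ = _ := by rw [← ht]; simp
  · rw [← hV]
    calc (R' ≫ X ◁ V) ≫ T ▷ X'' ≫ dag (R' ≫ X ◁ V)
        = (R' ≫ X ◁ (V ≫ dag V)) ≫ T ▷ X' ≫ dag R' := by
          simp only [dag_comp, dag_whiskerLeft, MonoidalCategory.whiskerLeft_comp, Category.assoc]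
          rw [← whisker_exchange_assoc]
      _ = _ := by rw [← ht']; simp

end Conjugation

/-! ### Finite dimensionality of the morphism spaces -/

section FiniteDimensional

variable {𝒞 : Type u} [Category.{v} 𝒞] [MonoidalCategory 𝒞] [CStarCategory 𝒞]

/-- Bessel's inequality in `(ι, M)`. -/
lemma sum_normSq_comp_le (h𝒞 : IsFiniteCStarTensorCategory 𝒞) {M N : 𝒞} {n : ℕ}
    (F : Fin n → (M ⟶ N)) (hF : ∀ i j, dag (F i) ≫ F j = if i = j then 𝟙 N else 0)
    (L : 𝟙_ 𝒞 ⟶ M) : ∑ i, ‖L ≫ F i‖ ^ 2 ≤ ‖L‖ ^ 2 := by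
  set P : M ⟶ M := ∑ i, F i ≫ dag (F i) with hP
  have h1 : dag P = P := by simp [hP, dag_sum, dag_comp]
  have h2 : P ≫ P = P := by
    rw [hP, Preadditive.sum_comp]
    refine Finset.sum_congr rfl fun i _ => ?_
    rw [Preadditive.comp_sum, Finset.sum_eq_single i]
    · rw [Category.assoc, ← Category.assoc (dag (F i)), hF, if_pos rfl, Category.id_comp]
    · intro j _ hj
      rw [Category.assoc, ← Category.assoc (dag (F i)), hF, if_neg (Ne.symm hj)]
      simp
    · simp
  have h3 : (((∑ i, ‖L ≫ F i‖ ^ 2 : ℝ)) : ℂ) = ((‖L ≫ P‖ ^ 2 : ℝ) : ℂ) := by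
    apply smul_id_injective (𝟙_ 𝒞)
    dsimp only
    rw [← comp_dag_unit h𝒞, dag_comp, h1, Category.assoc, reassoc_of% h2, hP, Complex.ofReal_sum,
      Finset.sum_smul, Preadditive.sum_comp, Preadditive.comp_sum]
    refine Finset.sum_congr rfl fun i _ => ?_
    rw [← comp_dag_unit h𝒞]
    simp [dag_comp]
  have h4 : ∑ i, ‖L ≫ F i‖ ^ 2 = ‖L ≫ P‖ ^ 2 := by exact_mod_cast h3
  rw [h4]
  have h5 : ‖L ≫ P‖ ≤ ‖L‖ := (norm_comp_le L P).trans
    (by nlinarith [norm_le_one_of_projection h1 h2, norm_nonneg L])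
  exact pow_le_pow_left₀ (norm_nonneg _) h5 2

variable [CStarTensorCategory 𝒞]

lemma norm_rightUnitor_hom_le (X : 𝒞) : ‖(ρ_ X).hom‖ ≤ 1 :=
  norm_le_one_of_isIsometry (by simp [IsIsometry])

lemma norm_leftUnitor_hom_le (X : 𝒞) : ‖(λ_ X).hom‖ ≤ 1 :=
  norm_le_one_of_isIsometry (by simp [IsIsometry])

/-- Orthonormal families in `(ι, K)` have bounded length when `K` has a conjugate: bending the
`n` vectors of such a family gives vectors `kᵢ`, `lᵢ` with `lᵢ* ∘ kᵢ = 1`, while the sums of the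
`‖kᵢ‖²` and of the `‖lᵢ‖²` are bounded independently of `n`. -/
lemma card_orthonormal_le (h𝒞 : IsFiniteCStarTensorCategory 𝒞) {K K' : 𝒞}
    {R : 𝟙_ 𝒞 ⟶ K' ⊗ K} {R' : 𝟙_ 𝒞 ⟶ K ⊗ K'} (h : IsConjugationPair K K' R R') {n : ℕ}
    (e : Fin n → (𝟙_ 𝒞 ⟶ K)) (he : ∀ i j, e i ≫ dag (e j) = if i = j then 𝟙 (𝟙_ 𝒞) else 0) :
    2 * (n : ℝ) ≤ ‖R‖ ^ 2 + ‖R'‖ ^ 2 := by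
  have hk := sum_normSq_comp_le h𝒞 (fun i => K' ◁ dag (e i)) (fun i j => by
    rw [dag_whiskerLeft, dag_dag, ← MonoidalCategory.whiskerLeft_comp, he]
    split_ifs <;> simp) R
  have hl := sum_normSq_comp_le h𝒞 (fun i => dag (e i) ▷ K') (fun i j => by
    rw [dag_whiskerRight, dag_dag, ← comp_whiskerRight, he]
    split_ifs <;> simp) R'
  have hkl : ∀ i, 2 ≤ ‖R ≫ K' ◁ dag (e i)‖ ^ 2 + ‖R' ≫ dag (e i) ▷ K'‖ ^ 2 := by
    intro i
    set k := R ≫ K' ◁ dag (e i) with hkd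
    set l := R' ≫ dag (e i) ▷ K' with hld
    have h1 : (k ≫ (ρ_ K').hom) ≫ dag (l ≫ (λ_ K').hom) = 𝟙 (𝟙_ 𝒞) := by
      have h2 : e i ≫ bend R' k = 𝟙 (𝟙_ 𝒞) := by
        rw [bend_comp_whiskerLeft h, he, if_pos rfl]
      rw [← h2, bend, rightUnitor_inv_naturality_assoc, ← whisker_exchange_assoc,
        associator_inv_naturality_left_assoc, hld, dag_comp, dag_comp, dag_leftUnitor,
        dag_whiskerRight, dag_dag]
      monoidal
    have h3 : (1 : ℝ) ≤ ‖k‖ * ‖l‖ := by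
      calc (1 : ℝ) = ‖(k ≫ (ρ_ K').hom) ≫ dag (l ≫ (λ_ K').hom)‖ := by rw [h1, norm_id]
        _ ≤ ‖dag (l ≫ (λ_ K').hom)‖ * ‖k ≫ (ρ_ K').hom‖ := norm_comp_le _ _
        _ ≤ ‖l‖ * ‖k‖ := by
          rw [norm_dag]
          refine mul_le_mul ((norm_comp_le _ _).trans ?_) ((norm_comp_le _ _).trans ?_)
            (norm_nonneg _) (norm_nonneg _)
          · exact mul_le_of_le_one_left (norm_nonneg _) (norm_leftUnitor_hom_le _)
          · exact mul_le_of_le_one_left (norm_nonneg _) (norm_rightUnitor_hom_le _)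
        _ = ‖k‖ * ‖l‖ := mul_comm _ _
    nlinarith [sq_nonneg (‖k‖ - ‖l‖)]
  have hsum := Finset.sum_le_sum fun i (_ : i ∈ Finset.univ) => hkl i
  rw [Finset.sum_add_distrib] at hsum
  simp only [Finset.sum_const, Finset.card_univ, Fintype.card_fin, nsmul_eq_mul] at hsum
  linarith

lemma finiteDimensional_unit_hom (h𝒞 : IsFiniteCStarTensorCategory 𝒞) (K : 𝒞) :
    FiniteDimensional ℂ (𝟙_ 𝒞 ⟶ K) := by
  classical
  by_contra hfin
  obtain ⟨K', R, R', h⟩ := h𝒞.conjugates K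
  have τ := h𝒞.unit_irreducible
  have key : ∀ n : ℕ, ∃ e : Fin n → (𝟙_ 𝒞 ⟶ K),
      ∀ i j, e i ≫ dag (e j) = if i = j then 𝟙 (𝟙_ 𝒞) else 0 := by
    intro n
    induction n with
    | zero => exact ⟨Fin.elim0, fun i => i.elim0⟩
    | succ n ih =>
      obtain ⟨e, he⟩ := ih
      obtain ⟨f, hf⟩ : ∃ f, f ∉ Submodule.span ℂ (Set.range e) := by
        by_contra! hall
        refine hfin ⟨⟨Finset.univ.image e, ?_⟩⟩
        rw [Finset.coe_image, Finset.coe_univ, Set.image_univ, eq_top_iff]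
        exact fun f _ => hall f
      -- one step of the Gram-Schmidt process
      set g := f - ∑ i, τ.coeff (f ≫ dag (e i)) • e i with hg
      have hg0 : g ≠ 0 := by
        intro h0
        apply hf
        rw [sub_eq_zero.1 h0]
        exact Submodule.sum_mem _ fun i _ =>
          Submodule.smul_mem _ _ (Submodule.subset_span ⟨i, rfl⟩)
      have hge : ∀ j, g ≫ dag (e j) = 0 := by
        intro j
        rw [hg, Preadditive.sub_comp, Preadditive.sum_comp, Finset.sum_eq_single j]
        · rw [Linear.smul_comp, he, if_pos rfl, τ.coeff_smul, sub_self]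
        · intro i _ hi
          rw [Linear.smul_comp, he, if_neg hi, smul_zero]
        · simp
      have hgn := comp_dag_unit h𝒞 g
      have hn : ‖g‖ ≠ 0 := norm_ne_zero_iff.2 hg0
      refine ⟨Fin.snoc e (((‖g‖⁻¹ : ℝ) : ℂ) • g), fun i j => ?_⟩
      induction i using Fin.lastCases with
      | last =>
        induction j using Fin.lastCases with
        | last =>
          simp only [Fin.snoc_last, dag_smul, Linear.smul_comp, Linear.comp_smul, if_true, hgn,
            smul_smul]
          rw [Complex.star_def, Complex.conj_ofReal, ← Complex.ofReal_mul, ← Complex.ofReal_mul]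
          rw [show ‖g‖⁻¹ * (‖g‖⁻¹ * ‖g‖ ^ 2) = 1 by field_simp]
          simp
        | cast j =>
          rw [Fin.snoc_last, Fin.snoc_castSucc, Linear.smul_comp, hge, smul_zero,
            if_neg (Fin.castSucc_lt_last j).ne']
      | cast i =>
        induction j using Fin.lastCases with
        | last =>
          rw [Fin.snoc_last, Fin.snoc_castSucc, dag_smul, Linear.comp_smul,
            show e i ≫ dag g = 0 by rw [← dag_dag (e i), ← dag_comp, hge, dag_zero], smul_zero,
            if_neg (Fin.castSucc_lt_last i).ne]
        | cast j =>
          simp only [Fin.snoc_castSucc, he, Fin.castSucc_inj]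
  obtain ⟨n, hn⟩ := exists_nat_gt (‖R‖ ^ 2 + ‖R'‖ ^ 2)
  obtain ⟨e, he⟩ := key n
  have := card_orthonormal_le h𝒞 h e he
  have h0 : (0 : ℝ) ≤ n := Nat.cast_nonneg n
  linarith

lemma finiteDimensional_hom (h𝒞 : IsFiniteCStarTensorCategory 𝒞) (X Y : 𝒞) :
    FiniteDimensional ℂ (X ⟶ Y) := by
  obtain ⟨X', R, R', h⟩ := h𝒞.conjugates X
  have := finiteDimensional_unit_hom h𝒞 (X' ⊗ Y)
  let φ : (X ⟶ Y) →ₗ[ℂ] (𝟙_ 𝒞 ⟶ X' ⊗ Y) :=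
    { toFun := fun t => R ≫ X' ◁ t
      map_add' := fun s t => by simp
      map_smul' := fun c t => by simp }
  exact FiniteDimensional.of_injective φ (bijective_comp_whiskerLeft h Y).1

lemma finiteDimensional_end (h𝒞 : IsFiniteCStarTensorCategory 𝒞) (X : 𝒞) :
    FiniteDimensional ℂ (End X) := finiteDimensional_hom h𝒞 X X

end FiniteDimensional

/-! ### Decomposition into irreducible objects -/

section Decomposition

variable {𝒞 : Type u} [Category.{v} 𝒞] [CStarCategory 𝒞]

/-- A selfadjoint non-scalar element of a finite dimensional `(X, X)` has a nontrivial spectral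
projection. -/
lemma exists_projection_of_selfAdjoint {X : 𝒞} [FiniteDimensional ℂ (End X)] {h : End X}
    (hh : star h = h) (hs : ∀ c : ℂ, h ≠ c • 1) :
    ∃ E : End X, IsStarProjection E ∧ E ≠ 0 ∧ E ≠ 1 := by
  have hstar : ∀ a : End X, star a * a = 0 → a = 0 := fun a ha =>
    eq_zero_of_comp_dag (f := (a : X ⟶ X)) ha
  have : Nontrivial (End X) := ⟨⟨1, 0, id_ne_zero X⟩⟩
  have hint : IsIntegral ℂ h := Algebra.IsIntegral.isIntegral h
  obtain ⟨c, hc⟩ := Complex.exists_root (minpoly.degree_pos hint)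
  obtain ⟨q, hq⟩ := Polynomial.dvd_iff_isRoot.2 hc
  have hq0 : q ≠ 0 := by
    rintro rfl
    exact minpoly.ne_zero hint (by rw [hq, mul_zero])
  -- `N` is nonzero, commutes with `h` and has range in the eigenspace of `c`; as `h` acts on that
  -- range as a scalar, so does `N = q(h)`, and `N* N` is a multiple of a projection
  set N : End X := Polynomial.aeval h q with hN
  have hN0 : N ≠ 0 := by
    intro h0
    have h1 := minpoly.degree_le_of_ne_zero ℂ h hq0 h0
    rw [hq, Polynomial.degree_mul, Polynomial.degree_X_sub_C,
      Polynomial.degree_eq_natDegree hq0] at h1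
    have h2 : 1 + q.natDegree ≤ q.natDegree := by exact_mod_cast h1
    omega
  have hcN : h * N = c • N := by
    have h1 : Polynomial.aeval h ((Polynomial.X - Polynomial.C c) * q) = 0 := by
      rw [← hq, minpoly.aeval]
    rw [map_mul, map_sub, Polynomial.aeval_X, Polynomial.aeval_C, sub_mul, ← hN,
      Algebra.algebraMap_eq_smul_one, smul_one_mul, sub_eq_zero] at h1
    exact h1
  have hNh : h * N = N * h := by
    have := congrArg (Polynomial.aeval h) (mul_comm Polynomial.X q)
    simpa using this
  set P : End X := star N * N with hP
  have hPs : star P = P := by rw [hP, star_mul, star_star]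
  have hP0 : P ≠ 0 := fun h0 => hN0 (hstar N h0)
  have hPP0 : P * P ≠ 0 := fun h0 => hP0 (hstar P (by rw [hPs, h0]))
  have hNsh : h * star N = star N * h := by
    have := congrArg star hNh
    rw [star_mul, star_mul, hh] at this
    exact this.symm
  have hhP : h * P = c • P := by
    rw [hP, ← mul_assoc, hNsh, mul_assoc, hcN, mul_smul_comm]
  have hPh' : P * h = star c • P := by
    have := congrArg star hhP
    rwa [star_mul, star_smul, hPs, hh] at this
  have hreal : star c = c := by
    have h1 : star c • (P * P) = c • (P * P) := by
      rw [← smul_mul_assoc, ← hPh', mul_assoc, hhP, mul_smul_comm]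
    exact smul_left_injective ℂ hPP0 h1
  have hPh : P * h = c • P := by rw [hPh', hreal]
  obtain ⟨s, hs'⟩ := Polynomial.X_sub_C_dvd_sub_C_eval (a := c) (p := q)
  have hNs : N = algebraMap ℂ (End X) (q.eval c) + (h - algebraMap ℂ (End X) c) *
      Polynomial.aeval h s := by
    have h1 := congrArg (Polynomial.aeval h) hs'
    rw [map_sub, map_mul, map_sub, Polynomial.aeval_C, Polynomial.aeval_C, Polynomial.aeval_X,
      ← hN, sub_eq_iff_eq_add] at h1
    rw [h1, add_comm]
  have hPN : P * N = q.eval c • P := by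
    rw [hNs, mul_add, ← mul_assoc, mul_sub, hPh, Algebra.algebraMap_eq_smul_one,
      Algebra.algebraMap_eq_smul_one, mul_smul_comm, mul_smul_comm, mul_one, sub_self, zero_mul,
      add_zero]
  have hNP : star N * P = star (q.eval c) • P := by
    have := congrArg star hPN
    rwa [star_mul, star_smul, hPs] at this
  set κ : ℂ := star (q.eval c) * q.eval c with hκ
  have hPP : P * P = κ • P := by
    conv_lhs => rw [hP]
    rw [← hP, mul_assoc]
    have hNP' : N * P = q.eval c • P := by
      have hcomm : N * (h - algebraMap ℂ (End X) c) = (h - algebraMap ℂ (End X) c) * N := by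
        rw [mul_sub, sub_mul, hNh, Algebra.commutes]
      have hsc : Polynomial.aeval h s * (h - algebraMap ℂ (End X) c)
          = (h - algebraMap ℂ (End X) c) * Polynomial.aeval h s := by
        have := congrArg (Polynomial.aeval h) (mul_comm s (Polynomial.X - Polynomial.C c))
        simpa using this
      rw [hNs, ← hsc, add_mul, mul_assoc, sub_mul, hhP, Algebra.algebraMap_eq_smul_one,
        Algebra.algebraMap_eq_smul_one, smul_one_mul, smul_one_mul, sub_self, mul_zero, add_zero]
    rw [hNP', mul_smul_comm, hNP, smul_smul, hκ, mul_comm]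
  have hκ0 : κ ≠ 0 := by
    intro h0
    rw [h0, zero_smul] at hPP
    exact hPP0 hPP
  have hκs : star κ = κ := by rw [hκ, star_mul, star_star]
  refine ⟨κ⁻¹ • P, ⟨?_, ?_⟩, smul_ne_zero (inv_ne_zero hκ0) hP0, ?_⟩
  · change κ⁻¹ • P * κ⁻¹ • P = κ⁻¹ • P
    rw [smul_mul_smul_comm, hPP, smul_smul]
    congr 1
    field_simp
  · change star (κ⁻¹ • P) = κ⁻¹ • P
    rw [star_smul, hPs, star_inv₀, hκs]
  · intro h1
    apply hs c
    rw [← mul_one h, ← h1, mul_smul_comm, hhP, smul_comm, h1]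

lemma exists_projection {X : 𝒞} [FiniteDimensional ℂ (End X)] (hX : ¬ IsIrreducible X) :
    ∃ E : End X, IsStarProjection E ∧ E ≠ 0 ∧ E ≠ 1 := by
  by_contra hE
  apply hX
  have hsa : ∀ h : End X, star h = h → ∃ c : ℂ, h = c • 1 := by
    intro h hh
    by_contra! hs
    exact hE (exists_projection_of_selfAdjoint hh hs)
  intro T
  let T' : End X := T
  obtain ⟨a, ha⟩ := hsa (T' + star T') (by rw [star_add, star_star, add_comm])
  obtain ⟨b, hb⟩ := hsa (Complex.I • (T' - star T')) (by
    rw [star_smul, star_sub, star_star, Complex.star_def, Complex.conj_I, neg_smul, ← smul_neg,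
      neg_sub])
  refine ⟨(2 : ℂ)⁻¹ * (a - Complex.I * b), ?_⟩
  change T' = ((2 : ℂ)⁻¹ * (a - Complex.I * b)) • (1 : End X)
  rw [mul_smul, sub_smul, ← ha, mul_smul, ← hb, smul_smul, Complex.I_mul_I, neg_smul, one_smul,
    neg_sub, sub_eq_add_neg, neg_sub]
  rw [show T' + star T' + (T' - star T') = (2 : ℂ) • T' by rw [two_smul]; abel, smul_smul]
  norm_num

/-- An orthogonal decomposition of `X` into irreducible objects `Y i`. -/
structure IsDecomposition {ι : Type*} [Fintype ι] (X : 𝒞) (Y : ι → 𝒞) (W : ∀ i, Y i ⟶ X) :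
    Prop where
  irreducible : ∀ i, IsIrreducible (Y i)
  isometry : ∀ i, IsIsometry (W i)
  sum_eq : ∑ i, dag (W i) ≫ W i = 𝟙 X

lemma finrank_end_lt {X Y : 𝒞} [FiniteDimensional ℂ (End X)]
    {V : Y ⟶ X} (hV : IsIsometry V) (hE : dag V ≫ V ≠ 𝟙 X) :
    Module.finrank ℂ (End Y) < Module.finrank ℂ (End X) := by
  let φ : End Y →ₗ[ℂ] End X :=
    { toFun := fun T => dag V ≫ (T : Y ⟶ Y) ≫ V
      map_add' := fun S T => by
        change dag V ≫ ((S : Y ⟶ Y) + T) ≫ V = dag V ≫ (S : Y ⟶ Y) ≫ V + dag V ≫ (T : Y ⟶ Y) ≫ V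
        rw [Preadditive.add_comp, Preadditive.comp_add]
      map_smul' := fun c T => by
        change dag V ≫ (c • (T : Y ⟶ Y)) ≫ V = c • (dag V ≫ (T : Y ⟶ Y) ≫ V)
        rw [Linear.smul_comp, Linear.comp_smul] }
  have hφ : Function.Injective φ := by
    intro S T hST
    have h1 : V ≫ (dag V ≫ (S : Y ⟶ Y) ≫ V) ≫ dag V = V ≫ (dag V ≫ (T : Y ⟶ Y) ≫ V) ≫ dag V :=
      congrArg (fun A : X ⟶ X => V ≫ A ≫ dag V) hST
    simp only [Category.assoc, show V ≫ dag V = 𝟙 Y from hV, Category.comp_id] at h1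
    rwa [reassoc_of% (show V ≫ dag V = 𝟙 Y from hV),
      reassoc_of% (show V ≫ dag V = 𝟙 Y from hV)] at h1
  rw [← LinearMap.finrank_range_of_inj hφ]
  apply Submodule.finrank_lt
  intro htop
  obtain ⟨T, hT⟩ : (𝟙 X : End X) ∈ LinearMap.range φ := by rw [htop]; trivial
  replace hT : dag V ≫ (T : Y ⟶ Y) ≫ V = 𝟙 X := hT
  apply hE
  calc dag V ≫ V = dag V ≫ V ≫ dag V ≫ (T : Y ⟶ Y) ≫ V := by rw [hT, Category.comp_id]
    _ = 𝟙 X := by rw [reassoc_of% (show V ≫ dag V = 𝟙 Y from hV), hT]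

variable [MonoidalCategory 𝒞]

/-- The isometries of a decomposition have orthogonal ranges: for fixed `i`, the sum of the positive
scalars `Wᵢ* Wⱼ Wⱼ* Wᵢ` over all `j` is `1`, and the term for `j = i` is already `1`. -/
lemma IsDecomposition.orthogonal (h𝒞 : IsFiniteCStarTensorCategory 𝒞) {ι : Type*} [Fintype ι]
    {X : 𝒞} {Y : ι → 𝒞} {W : ∀ i, Y i ⟶ X} (h : IsDecomposition X Y W) {i j : ι} (hij : i ≠ j) :
    W i ≫ dag (W j) = 0 := by
  classical
  set a : ∀ k, Y i ⟶ Y k := fun k => W i ≫ dag (W k) with ha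
  have hpos : ∀ k, a k ≫ dag (a k) = ((‖a k‖ ^ 2 : ℝ) : ℂ) • 𝟙 (Y i) := by
    intro k
    rw [← (h.irreducible i).coeff_comp_dag h𝒞, (h.irreducible i).coeff_smul]
  have hsum : ∑ k, a k ≫ dag (a k) = 𝟙 (Y i) := by
    have h1 : ∀ k, a k ≫ dag (a k) = W i ≫ (dag (W k) ≫ W k) ≫ dag (W i) := by
      intro k; simp [ha, dag_comp]
    simp_rw [h1]
    rw [← Preadditive.comp_sum, ← Preadditive.sum_comp, h.sum_eq, Category.id_comp]
    exact h.isometry i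
  have hai : a i = 𝟙 (Y i) := h.isometry i
  rw [← Finset.add_sum_erase _ _ (Finset.mem_univ i), hai, dag_id, Category.comp_id,
    add_eq_left] at hsum
  simp_rw [hpos, ← Finset.sum_smul, ← Complex.ofReal_sum] at hsum
  have h0 : ∑ k ∈ Finset.univ.erase i, ‖a k‖ ^ 2 = 0 := by
    have := (smul_eq_zero.1 hsum).resolve_right (id_ne_zero _)
    exact_mod_cast this
  rw [Finset.sum_eq_zero_iff_of_nonneg (fun _ _ => sq_nonneg _)] at h0
  have := h0 j (Finset.mem_erase.2 ⟨hij.symm, Finset.mem_univ j⟩)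
  exact norm_eq_zero.1 (pow_eq_zero_iff two_ne_zero |>.1 this)

lemma exists_directSum (h𝒞 : IsFiniteCStarTensorCategory 𝒞) (n : ℕ) (Y : Fin (n + 1) → 𝒞) :
    ∃ (Z : 𝒞) (V : ∀ i, Y i ⟶ Z), (∀ i, IsIsometry (V i)) ∧ ∑ i, dag (V i) ≫ V i = 𝟙 Z := by
  induction n with
  | zero =>
    refine ⟨Y 0, fun i => eqToHom (by rw [Subsingleton.elim (α := Fin 1) i 0]), fun i => ?_, ?_⟩
    · obtain rfl := Subsingleton.elim (α := Fin 1) i 0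
      simp [IsIsometry]
    · simp
  | succ n ih =>
    obtain ⟨Z₁, V₁, hV₁, hs₁⟩ := ih fun i => Y i.castSucc
    obtain ⟨Z, A, B, hA, hB, hAB⟩ := h𝒞.directSums Z₁ (Y (Fin.last (n + 1)))
    refine ⟨Z, Fin.lastCases B fun i => V₁ i ≫ A, fun i => ?_, ?_⟩
    · beta_reduce
      induction i using Fin.lastCases with
      | last => rw [Fin.lastCases_last]; exact hB
      | cast i =>
        rw [Fin.lastCases_castSucc, IsIsometry, dag_comp, Category.assoc,
          reassoc_of% (show A ≫ dag A = 𝟙 _ from hA)]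
        exact hV₁ i
    · rw [Fin.sum_univ_castSucc]
      simp only [Fin.lastCases_castSucc, Fin.lastCases_last]
      rw [← hAB]
      congr 1
      rw [show dag A ≫ A = dag A ≫ 𝟙 Z₁ ≫ A by rw [Category.id_comp], ← hs₁,
        Preadditive.sum_comp, Preadditive.comp_sum]
      exact Finset.sum_congr rfl fun i _ => by simp [dag_comp]

variable [CStarTensorCategory 𝒞]

lemma exists_decomposition_aux (h𝒞 : IsFiniteCStarTensorCategory 𝒞) (n : ℕ) :
    ∀ X : 𝒞, Module.finrank ℂ (End X) = n → ∃ (ι : Type) (_ : Fintype ι) (Y : ι → 𝒞)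
      (W : ∀ i, Y i ⟶ X), IsDecomposition X Y W := by
  induction n using Nat.strong_induction_on with
  | _ n ih =>
    intro X hn
    have := finiteDimensional_end h𝒞 X
    by_cases hX : IsIrreducible X
    · exact ⟨Unit, inferInstance, fun _ => X, fun _ => 𝟙 X, fun _ => hX,
        fun _ => by simp [IsIsometry], by simp⟩
    obtain ⟨E, hE, hE0, hE1⟩ := exists_projection hX
    obtain ⟨Y₁, V₁, hV₁, hVE₁⟩ := h𝒞.subobjects X E hE hE0
    obtain ⟨Y₂, V₂, hV₂, hVE₂⟩ := h𝒞.subobjects X (1 - E) hE.one_sub (sub_ne_zero.2 hE1.symm)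
    have hlt₁ := finrank_end_lt hV₁ (by rw [hVE₁]; exact hE1)
    have hlt₂ := finrank_end_lt hV₂ (by
      rw [hVE₂]
      intro h
      exact hE0 (sub_eq_self.1 (show (1 : End X) - E = 1 from h)))
    obtain ⟨ι₁, _, Z₁, W₁, h₁⟩ := ih _ (hn ▸ hlt₁) Y₁ rfl
    obtain ⟨ι₂, _, Z₂, W₂, h₂⟩ := ih _ (hn ▸ hlt₂) Y₂ rfl
    refine ⟨ι₁ ⊕ ι₂, inferInstance, Sum.elim Z₁ Z₂, fun
      | Sum.inl i => W₁ i ≫ V₁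
      | Sum.inr i => W₂ i ≫ V₂, ?_, ?_, ?_⟩
    · rintro (i | i)
      exacts [h₁.irreducible i, h₂.irreducible i]
    · rintro (i | i)
      · change (W₁ i ≫ V₁) ≫ dag (W₁ i ≫ V₁) = _
        rw [dag_comp, Category.assoc, reassoc_of% (show V₁ ≫ dag V₁ = 𝟙 Y₁ from hV₁)]
        exact h₁.isometry i
      · change (W₂ i ≫ V₂) ≫ dag (W₂ i ≫ V₂) = _
        rw [dag_comp, Category.assoc, reassoc_of% (show V₂ ≫ dag V₂ = 𝟙 Y₂ from hV₂)]
        exact h₂.isometry i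
    · rw [Fintype.sum_sum_type]
      change ∑ i, dag (W₁ i ≫ V₁) ≫ W₁ i ≫ V₁ + ∑ i, dag (W₂ i ≫ V₂) ≫ W₂ i ≫ V₂ = 𝟙 X
      have e₁ : ∑ i, dag (W₁ i ≫ V₁) ≫ W₁ i ≫ V₁ = E := by
        rw [← hVE₁, ← Category.comp_id (dag V₁), ← h₁.sum_eq, Preadditive.comp_sum,
          Preadditive.sum_comp]
        exact Finset.sum_congr rfl fun i _ => by simp [dag_comp]
      have e₂ : ∑ i, dag (W₂ i ≫ V₂) ≫ W₂ i ≫ V₂ = ((1 : End X) - E : End X) := by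
        rw [← hVE₂, ← Category.comp_id (dag V₂), ← h₂.sum_eq, Preadditive.comp_sum,
          Preadditive.sum_comp]
        exact Finset.sum_congr rfl fun i _ => by simp [dag_comp]
      rw [e₁, e₂]
      exact add_sub_cancel E (1 : End X)

lemma exists_decomposition (h𝒞 : IsFiniteCStarTensorCategory 𝒞) (X : 𝒞) :
    ∃ (n : ℕ) (Y : Fin n → 𝒞) (W : ∀ i, Y i ⟶ X), IsDecomposition X Y W := by
  obtain ⟨ι, _, Y, W, h⟩ := exists_decomposition_aux h𝒞 _ X rfl
  let e := (Fintype.equivFin ι).symm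
  refine ⟨Fintype.card ι, fun i => Y (e i), fun i => W (e i), fun i => h.irreducible _,
    fun i => h.isometry _, ?_⟩
  rw [← h.sum_eq]
  exact e.sum_comp fun i => dag (W i) ≫ W i

end Decomposition

/-! ### The dimension of irreducible objects -/

section IrreducibleDimension

variable {𝒞 : Type u} [Category.{v} 𝒞] [MonoidalCategory 𝒞] [CStarCategory 𝒞]

lemma IsIrredStandardPair.normSq_eq (h𝒞 : IsFiniteCStarTensorCategory 𝒞) {Y Y' : 𝒞}
    {S : 𝟙_ 𝒞 ⟶ Y' ⊗ Y} {S' : 𝟙_ 𝒞 ⟶ Y ⊗ Y'} (hS : IsIrredStandardPair Y Y' S S') :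
    ‖S'‖ ^ 2 = ‖S‖ ^ 2 := by
  have h := hS.2.2
  rw [comp_dag_unit h𝒞, comp_dag_unit h𝒞] at h
  exact_mod_cast (smul_id_injective _ h).symm

open Classical in
/-- The number `S* ∘ S = ‖S‖²` for a standard pair `(S, S')` of an irreducible object. -/
def irrDim (Y : 𝒞) : ℝ :=
  if h : ∃ (Y' : 𝒞) (S : 𝟙_ 𝒞 ⟶ Y' ⊗ Y) (S' : 𝟙_ 𝒞 ⟶ Y ⊗ Y'), IsIrredStandardPair Y Y' S S'
  then ‖h.choose_spec.choose‖ ^ 2 else 0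

variable [CStarTensorCategory 𝒞]

lemma IsIrredStandardPair.symm {Y Y' : 𝒞} {S : 𝟙_ 𝒞 ⟶ Y' ⊗ Y} {S' : 𝟙_ 𝒞 ⟶ Y ⊗ Y'}
    (hS : IsIrredStandardPair Y Y' S S') : IsIrredStandardPair Y' Y S' S := by
  refine ⟨fun T => ?_, hS.2.1.symm, hS.2.2.symm⟩
  obtain ⟨t, ht⟩ := (bijective_comp_whiskerLeft hS.2.1 Y).2 (S ≫ T ▷ Y)
  obtain ⟨c, rfl⟩ := hS.1 t
  refine ⟨c, (bijective_comp_whiskerRight hS.2.1 Y').1 ?_⟩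
  dsimp only at ht ⊢
  rw [← ht]
  simp

/-- The dimension of an irreducible object does not depend on the standard pair: the comparison
of two pairs is by scalars `a`, `a'` with `conj a' * a = 1`, and standardness gives `a = a'`,
while positivity gives `a > 0`. -/
lemma IsIrredStandardPair.normSq_unique (h𝒞 : IsFiniteCStarTensorCategory 𝒞) {Y Y' Y'' : 𝒞}
    {S : 𝟙_ 𝒞 ⟶ Y' ⊗ Y} {S' : 𝟙_ 𝒞 ⟶ Y ⊗ Y'} (hS : IsIrredStandardPair Y Y' S S')
    {Q : 𝟙_ 𝒞 ⟶ Y'' ⊗ Y} {Q' : 𝟙_ 𝒞 ⟶ Y ⊗ Y''} (hQ : IsIrredStandardPair Y Y'' Q Q') :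
    ‖S‖ ^ 2 = ‖Q‖ ^ 2 := by
  obtain ⟨t, t', htt, h1, h2⟩ := exists_comparison hS.2.1 hQ.2.1
  obtain ⟨a, rfl⟩ := hS.1 t
  obtain ⟨a', rfl⟩ := hS.1 t'
  have e1 := h1 (𝟙 Y)
  have e2 := h2 (𝟙 Y)
  simp only [Category.comp_id, MonoidalCategory.whiskerLeft_id, Category.id_comp,
    MonoidalLinear.whiskerLeft_smul, MonoidalLinear.smul_whiskerRight, Linear.smul_comp,
    Linear.comp_smul, comp_dag_unit h𝒞, smul_smul, id_whiskerRight] at e1 e2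
  replace e1 := smul_id_injective _ e1
  replace e2 := smul_id_injective _ e2
  rw [hQ.normSq_eq h𝒞, hS.normSq_eq h𝒞] at e2
  have hSpos : (0 : ℝ) < ‖S‖ ^ 2 := pow_pos (norm_pos_iff.2 hS.2.1.ne_zero) 2
  have hQpos : (0 : ℝ) < ‖Q‖ ^ 2 := pow_pos (norm_pos_iff.2 hQ.2.1.ne_zero) 2
  have hS0 : ((‖S‖ ^ 2 : ℝ) : ℂ) ≠ 0 := by exact_mod_cast hSpos.ne'
  have haa : a = a' := mul_right_cancel₀ hS0 (e1.symm.trans e2)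
  subst haa
  have ha : a = ((‖Q‖ ^ 2 / ‖S‖ ^ 2 : ℝ) : ℂ) := by
    rw [Complex.ofReal_div, e1, mul_div_cancel_right₀ _ hS0]
  simp only [dag_smul, dag_id, Linear.smul_comp, Linear.comp_smul, Category.id_comp,
    smul_smul] at htt
  have h3 : star a * a = 1 := by
    have h4 : (a * star a) • 𝟙 Y = (1 : ℂ) • 𝟙 Y := by rw [one_smul]; exact mul_comm a _ ▸ htt
    rw [mul_comm]
    exact smul_id_injective Y h4
  rw [ha, Complex.star_def, Complex.conj_ofReal, ← Complex.ofReal_mul] at h3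
  have h5 : (‖Q‖ ^ 2 / ‖S‖ ^ 2) * (‖Q‖ ^ 2 / ‖S‖ ^ 2) = 1 := by exact_mod_cast h3
  have h6 : ‖Q‖ ^ 2 / ‖S‖ ^ 2 = 1 := by
    have : 0 < ‖Q‖ ^ 2 / ‖S‖ ^ 2 := div_pos hQpos hSpos
    nlinarith
  rw [div_eq_one_iff_eq hSpos.ne'] at h6
  exact h6.symm

lemma IsIrredStandardPair.irrDim_eq (h𝒞 : IsFiniteCStarTensorCategory 𝒞) {Y Y' : 𝒞}
    {S : 𝟙_ 𝒞 ⟶ Y' ⊗ Y} {S' : 𝟙_ 𝒞 ⟶ Y ⊗ Y'} (hS : IsIrredStandardPair Y Y' S S') :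
    irrDim Y = ‖S‖ ^ 2 := by
  have h : ∃ (Y' : 𝒞) (S : 𝟙_ 𝒞 ⟶ Y' ⊗ Y) (S' : 𝟙_ 𝒞 ⟶ Y ⊗ Y'),
    IsIrredStandardPair Y Y' S S' := ⟨Y', S, S', hS⟩
  rw [irrDim, dif_pos h]
  exact h.choose_spec.choose_spec.choose_spec.normSq_unique h𝒞 hS

lemma exists_irredStandardPair (h𝒞 : IsFiniteCStarTensorCategory 𝒞) {Y : 𝒞}
    (hY : IsIrreducible Y) : ∃ (Y' : 𝒞) (S : 𝟙_ 𝒞 ⟶ Y' ⊗ Y) (S' : 𝟙_ 𝒞 ⟶ Y ⊗ Y'),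
      IsIrredStandardPair Y Y' S S' := by
  obtain ⟨Y', S, S', h⟩ := h𝒞.conjugates Y
  have hS : 0 < ‖S‖ := norm_pos_iff.2 h.ne_zero
  have hS' : 0 < ‖S'‖ := norm_pos_iff.2 h.symm.ne_zero
  -- `(x S, x⁻¹ S')` is again a pair of conjugation operators, and this `x` balances the norms
  set x : ℝ := √(‖S'‖ / ‖S‖) with hx
  have hx0 : 0 < x := Real.sqrt_pos.2 (div_pos hS' hS)
  have hx2 : x ^ 2 = ‖S'‖ / ‖S‖ := Real.sq_sqrt (div_pos hS' hS).le
  have hxc : (x : ℂ) ≠ 0 := by exact_mod_cast hx0.ne'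
  have hxs : star (x : ℂ) = x := Complex.conj_ofReal x
  refine ⟨Y', (x : ℂ) • S, (x : ℂ)⁻¹ • S', hY, ⟨?_, ?_⟩, ?_⟩
  · simp only [dag_smul, star_inv₀, hxs, MonoidalLinear.whiskerLeft_smul,
      MonoidalLinear.smul_whiskerRight, Linear.smul_comp, Linear.comp_smul, smul_smul]
    rw [h.1]
    simp [hxc]
  · simp only [dag_smul, hxs, MonoidalLinear.whiskerLeft_smul,
      MonoidalLinear.smul_whiskerRight, Linear.smul_comp, Linear.comp_smul, smul_smul]
    rw [h.2]
    simp [hxc]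
  · rw [comp_dag_unit h𝒞, comp_dag_unit h𝒞, norm_smul, norm_smul, norm_inv, Complex.norm_real,
      Real.norm_eq_abs, abs_of_pos hx0, mul_pow, mul_pow, inv_pow, hx2]
    congr 2
    field_simp

lemma irrDim_pos (h𝒞 : IsFiniteCStarTensorCategory 𝒞) {Y : 𝒞} (hY : IsIrreducible Y) :
    0 < irrDim Y := by
  obtain ⟨Y', S, S', hS⟩ := exists_irredStandardPair h𝒞 hY
  rw [hS.irrDim_eq h𝒞]
  exact pow_pos (norm_pos_iff.2 hS.2.1.ne_zero) 2

lemma IsConjugationPair.comp_unitary {Y Y' Z : 𝒞} {S : 𝟙_ 𝒞 ⟶ Y' ⊗ Y} {S' : 𝟙_ 𝒞 ⟶ Y ⊗ Y'}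
    (hS : IsConjugationPair Y Y' S S') {U : Y ⟶ Z} (h1 : U ≫ dag U = 𝟙 Y)
    (h2 : dag U ≫ U = 𝟙 Z) : IsConjugationPair Z Y' (S ≫ Y' ◁ U) (S' ≫ U ▷ Y') := by
  constructor
  · have e : dag U ≫ ((ρ_ Y).inv ≫ Y ◁ S ≫ (α_ Y Y' Y).inv ≫ dag S' ▷ Y ≫ (λ_ Y).hom) ≫ U =
        𝟙 Z := by rw [hS.1, Category.id_comp, h2]
    rw [← e]
    simp only [dag_comp, dag_whiskerRight, comp_whiskerRight, MonoidalCategory.whiskerLeft_comp,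
      Category.assoc]
    rw [rightUnitor_inv_naturality_assoc, ← whisker_exchange_assoc,
      associator_inv_naturality_right_assoc, associator_inv_naturality_left_assoc,
      ← leftUnitor_naturality, whisker_exchange_assoc, whisker_exchange_assoc]
  · have e := hS.2
    rw [← e]
    have h3 : Y' ◁ U ▷ Y' ≫ (α_ Y' Z Y').inv ≫ (Y' ◁ dag U) ▷ Y' =
        (α_ Y' Y Y').inv := by
      rw [associator_inv_naturality_middle_assoc, ← comp_whiskerRight,
        ← MonoidalCategory.whiskerLeft_comp, h1]
      simp
    simp only [dag_comp, dag_whiskerLeft, comp_whiskerRight, MonoidalCategory.whiskerLeft_comp,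
      Category.assoc]
    rw [reassoc_of% h3]

lemma irrDim_eq_of_unitary (h𝒞 : IsFiniteCStarTensorCategory 𝒞) {Y Z : 𝒞}
    (hY : IsIrreducible Y) (hZ : IsIrreducible Z) {U : Y ⟶ Z} (h1 : U ≫ dag U = 𝟙 Y)
    (h2 : dag U ≫ U = 𝟙 Z) : irrDim Y = irrDim Z := by
  obtain ⟨Y', S, S', hS⟩ := exists_irredStandardPair h𝒞 hY
  have e1 : (S ≫ Y' ◁ U) ≫ dag (S ≫ Y' ◁ U) = S ≫ dag S := by
    rw [dag_comp, Category.assoc, dag_whiskerLeft, ← MonoidalCategory.whiskerLeft_comp_assoc, h1]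
    simp
  have e2 : (S' ≫ U ▷ Y') ≫ dag (S' ≫ U ▷ Y') = S' ≫ dag S' := by
    rw [dag_comp, Category.assoc, dag_whiskerRight, ← comp_whiskerRight_assoc, h1]
    simp
  have hZS : IsIrredStandardPair Z Y' (S ≫ Y' ◁ U) (S' ≫ U ▷ Y') :=
    ⟨hZ, hS.2.1.comp_unitary h1 h2, by rw [e1, e2, hS.2.2]⟩
  rw [hS.irrDim_eq h𝒞, hZS.irrDim_eq h𝒞]
  rw [comp_dag_unit h𝒞, comp_dag_unit h𝒞] at e1
  exact_mod_cast (smul_id_injective _ e1).symm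

/-- Schur's lemma in weighted form: the functionals `irrDim Y * coeff` are compatible with
cyclic permutation of morphisms between irreducible objects. -/
lemma irrDim_mul_coeff_comm (h𝒞 : IsFiniteCStarTensorCategory 𝒞) {Y Z : 𝒞}
    (hY : IsIrreducible Y) (hZ : IsIrreducible Z) (a : Y ⟶ Z) (b : Z ⟶ Y) :
    (irrDim Y : ℂ) * hY.coeff (a ≫ b) = irrDim Z * hZ.coeff (b ≫ a) := by
  by_cases ha : a = 0
  · simp [ha]
  have hcc : hY.coeff (a ≫ b) = hZ.coeff (b ≫ a) := by
    have h1 : hY.coeff (a ≫ b) • a = hZ.coeff (b ≫ a) • a := by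
      calc hY.coeff (a ≫ b) • a = (hY.coeff (a ≫ b) • 𝟙 Y) ≫ a := by simp
        _ = a ≫ (hZ.coeff (b ≫ a) • 𝟙 Z) := by
          rw [hY.coeff_smul, hZ.coeff_smul, Category.assoc]
        _ = _ := by simp
    exact smul_left_injective ℂ ha h1
  have hn : 0 < ‖a‖ := norm_pos_iff.2 ha
  have h1 : a ≫ dag a = ((‖a‖ ^ 2 : ℝ) : ℂ) • 𝟙 Y := by
    rw [← hY.coeff_comp_dag h𝒞, hY.coeff_smul]
  have h2 : dag a ≫ a = ((‖a‖ ^ 2 : ℝ) : ℂ) • 𝟙 Z := by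
    have := hZ.coeff_comp_dag h𝒞 (dag a)
    rw [dag_dag, norm_dag] at this
    rw [← this, hZ.coeff_smul]
  have hs : star ((‖a‖⁻¹ : ℝ) : ℂ) = ((‖a‖⁻¹ : ℝ) : ℂ) := Complex.conj_ofReal _
  have h3 : ((‖a‖⁻¹ : ℝ) : ℂ) * (((‖a‖⁻¹ : ℝ) : ℂ) * ((‖a‖ ^ 2 : ℝ) : ℂ)) = 1 := by
    rw [← Complex.ofReal_mul, ← Complex.ofReal_mul,
      show ‖a‖⁻¹ * (‖a‖⁻¹ * ‖a‖ ^ 2) = 1 by field_simp, Complex.ofReal_one]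
  have hd : irrDim Y = irrDim Z :=
    irrDim_eq_of_unitary h𝒞 hY hZ (U := ((‖a‖⁻¹ : ℝ) : ℂ) • a)
      (by rw [dag_smul, Linear.smul_comp, Linear.comp_smul, h1, smul_smul, smul_smul, hs, mul_assoc, h3,
            one_smul])
      (by rw [dag_smul, Linear.smul_comp, Linear.comp_smul, h2, smul_smul, smul_smul, hs, mul_assoc, h3,
            one_smul])
  rw [hcc, hd]

end IrreducibleDimension

/-! ### The canonical trace -/

section Trace

variable {𝒞 : Type u} [Category.{v} 𝒞] [MonoidalCategory 𝒞] [CStarCategory 𝒞]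

/-- The trace on `(X, X)` computed from a decomposition of `X` into irreducible objects: the sum
of the diagonal coefficients, weighted by the dimensions. -/
def IsDecomposition.trace {ι : Type*} [Fintype ι] {X : 𝒞} {Y : ι → 𝒞} {W : ∀ i, Y i ⟶ X}
    (h : IsDecomposition X Y W) : (X ⟶ X) →ₗ[ℂ] ℂ where
  toFun T := ∑ i, (irrDim (Y i) : ℂ) * (h.irreducible i).coeff (W i ≫ T ≫ dag (W i))
  map_add' S T := by
    simp only [Preadditive.add_comp, Preadditive.comp_add, map_add, mul_add,
      Finset.sum_add_distrib]
  map_smul' c T := by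
    simp only [Linear.smul_comp, Linear.comp_smul, map_smul, RingHom.id_apply, smul_eq_mul,
      Finset.mul_sum]
    exact Finset.sum_congr rfl fun i _ => by ring

lemma IsDecomposition.trace_apply {ι : Type*} [Fintype ι] {X : 𝒞} {Y : ι → 𝒞}
    {W : ∀ i, Y i ⟶ X} (h : IsDecomposition X Y W) (T : X ⟶ X) : h.trace T =
      ∑ i, (irrDim (Y i) : ℂ) * (h.irreducible i).coeff (W i ≫ T ≫ dag (W i)) := rfl

variable [CStarTensorCategory 𝒞]

lemma IsDecomposition.trace_comm (h𝒞 : IsFiniteCStarTensorCategory 𝒞) {ι κ : Type*} [Fintype ι]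
    [Fintype κ] {X Z : 𝒞} {Y : ι → 𝒞} {W : ∀ i, Y i ⟶ X} (h : IsDecomposition X Y W)
    {Y₂ : κ → 𝒞} {V : ∀ j, Y₂ j ⟶ Z} (h₂ : IsDecomposition Z Y₂ V) (f : X ⟶ Z) (g : Z ⟶ X) :
    h.trace (f ≫ g) = h₂.trace (g ≫ f) := by
  have e1 : ∀ i, W i ≫ (f ≫ g) ≫ dag (W i) =
      ∑ j, (W i ≫ f ≫ dag (V j)) ≫ (V j ≫ g ≫ dag (W i)) := by
    intro i
    have : W i ≫ (f ≫ g) ≫ dag (W i) = W i ≫ f ≫ 𝟙 Z ≫ g ≫ dag (W i) := by simp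
    rw [this, ← h₂.sum_eq, Preadditive.sum_comp, Preadditive.comp_sum, Preadditive.comp_sum]
    exact Finset.sum_congr rfl fun j _ => by simp
  have e2 : ∀ j, V j ≫ (g ≫ f) ≫ dag (V j) =
      ∑ i, (V j ≫ g ≫ dag (W i)) ≫ (W i ≫ f ≫ dag (V j)) := by
    intro j
    have : V j ≫ (g ≫ f) ≫ dag (V j) = V j ≫ g ≫ 𝟙 X ≫ f ≫ dag (V j) := by simp
    rw [this, ← h.sum_eq, Preadditive.sum_comp, Preadditive.comp_sum, Preadditive.comp_sum]
    exact Finset.sum_congr rfl fun j _ => by simp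
  simp only [IsDecomposition.trace_apply, e1, e2, map_sum, Finset.mul_sum]
  rw [Finset.sum_comm]
  exact Finset.sum_congr rfl fun j _ => Finset.sum_congr rfl fun i _ =>
    irrDim_mul_coeff_comm h𝒞 _ _ _ _

/-- The canonical trace on `(X, X)`, normalized so that its value at `1` is the dimension of `X`.
It is computed from a chosen decomposition; see `IsDecomposition.trace_eq` for the independence of
the choice. -/
def canTrace (h𝒞 : IsFiniteCStarTensorCategory 𝒞) (X : 𝒞) : (X ⟶ X) →ₗ[ℂ] ℂ :=
  (exists_decomposition h𝒞 X).choose_spec.choose_spec.choose_spec.trace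

variable (h𝒞 : IsFiniteCStarTensorCategory 𝒞)

lemma IsDecomposition.trace_eq {ι : Type*} [Fintype ι] {X : 𝒞} {Y : ι → 𝒞} {W : ∀ i, Y i ⟶ X}
    (h : IsDecomposition X Y W) : h.trace = canTrace h𝒞 X := by
  ext T
  have := h.trace_comm h𝒞 (exists_decomposition h𝒞 X).choose_spec.choose_spec.choose_spec (𝟙 X) T
  rwa [Category.id_comp, Category.comp_id] at this

lemma canTrace_comm {X Y : 𝒞} (f : X ⟶ Y) (g : Y ⟶ X) :
    canTrace h𝒞 X (f ≫ g) = canTrace h𝒞 Y (g ≫ f) :=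
  IsDecomposition.trace_comm h𝒞 _ _ f g

lemma canTrace_irreducible {Y : 𝒞} (hY : IsIrreducible Y) (T : Y ⟶ Y) :
    canTrace h𝒞 Y T = irrDim Y * hY.coeff T := by
  have h : IsDecomposition (ι := Unit) Y (fun _ => Y) (fun _ => 𝟙 Y) :=
    ⟨fun _ => hY, fun _ => by simp [IsIsometry], by simp⟩
  rw [← h.trace_eq h𝒞, h.trace_apply]
  simp

lemma canTrace_comp_dag {X Y : 𝒞} (f : X ⟶ Y) :
    ∃ r : ℝ, 0 ≤ r ∧ canTrace h𝒞 X (f ≫ dag f) = r ∧ (r = 0 → f = 0) := by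
  obtain ⟨n, Z, W, h⟩ := exists_decomposition h𝒞 X
  refine ⟨∑ i, irrDim (Z i) * ‖W i ≫ f‖ ^ 2, Finset.sum_nonneg fun i _ =>
    mul_nonneg (irrDim_pos h𝒞 (h.irreducible i)).le (sq_nonneg _), ?_, fun h0 => ?_⟩
  · rw [← h.trace_eq h𝒞, h.trace_apply, Complex.ofReal_sum]
    refine Finset.sum_congr rfl fun i _ => ?_
    rw [Complex.ofReal_mul, ← (h.irreducible i).coeff_comp_dag h𝒞]
    simp [dag_comp]
  · rw [Finset.sum_eq_zero_iff_of_nonneg fun i _ =>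
      mul_nonneg (irrDim_pos h𝒞 (h.irreducible i)).le (sq_nonneg _)] at h0
    rw [← Category.id_comp f, ← h.sum_eq, Preadditive.sum_comp]
    refine Finset.sum_eq_zero fun i hi => ?_
    have h1 := (mul_eq_zero.1 (h0 i hi)).resolve_left (irrDim_pos h𝒞 (h.irreducible i)).ne'
    rw [Category.assoc, norm_eq_zero.1 (pow_eq_zero_iff two_ne_zero |>.1 h1), Limits.comp_zero]

lemma eq_zero_of_canTrace {X Y : 𝒞} {f : X ⟶ Y} (h : canTrace h𝒞 X (f ≫ dag f) = 0) :
    f = 0 := by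
  obtain ⟨r, -, h1, h2⟩ := canTrace_comp_dag h𝒞 f
  exact h2 (by exact_mod_cast h1.symm.trans h)

lemma canTrace_dag {X : 𝒞} (T : X ⟶ X) : canTrace h𝒞 X (dag T) = star (canTrace h𝒞 X T) := by
  obtain ⟨n, Z, W, h⟩ := exists_decomposition h𝒞 X
  rw [← h.trace_eq h𝒞, h.trace_apply, h.trace_apply, star_sum]
  refine Finset.sum_congr rfl fun i _ => ?_
  rw [star_mul, ← (h.irreducible i).coeff_dag, Complex.star_def, Complex.conj_ofReal, mul_comm]
  simp [dag_comp]

end Trace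

/-! ### Standard pairs of conjugation operators -/

section Standard

variable {𝒞 : Type u} [Category.{v} 𝒞] [MonoidalCategory 𝒞] [CStarCategory 𝒞]
  [CStarTensorCategory 𝒞]

lemma IsStandardPair.symm {X X' : 𝒞} {R : 𝟙_ 𝒞 ⟶ X' ⊗ X} {R' : 𝟙_ 𝒞 ⟶ X ⊗ X'}
    (h : IsStandardPair X X' R R') : IsStandardPair X' X R' R := by
  obtain ⟨n, Y, Y', W, W', S, S', hS, hW, hW', hs, hs', hR, hR'⟩ := h
  exact ⟨n, Y', Y, W', W, S', S, fun i => (hS i).symm, hW', hW, hs', hs, hR', hR⟩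

lemma IsStandardPair.isConjugationPair_left (h𝒞 : IsFiniteCStarTensorCategory 𝒞) {X X' : 𝒞}
    {R : 𝟙_ 𝒞 ⟶ X' ⊗ X} {R' : 𝟙_ 𝒞 ⟶ X ⊗ X'} (h : IsStandardPair X X' R R') :
    (ρ_ X).inv ≫ X ◁ R ≫ (α_ X X' X).inv ≫ dag R' ▷ X ≫ (λ_ X).hom = 𝟙 X := by
  obtain ⟨n, Y, Y', W, W', S, S', hS, hW, hW', hs, hs', hR, hR'⟩ := h
  have hd' : IsDecomposition X' Y' W' := ⟨fun i => (hS i).symm.1, hW', hs'⟩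
  have key : ∀ i, X ◁ W' i ≫ dag R' = dag (W i) ▷ Y' i ≫ dag (S' i) := by
    intro i
    rw [hR', dag_sum, Preadditive.comp_sum, Finset.sum_eq_single i]
    · rw [dag_comp, dag_tensor, MonoidalCategory.tensorHom_def', Category.assoc, ← Category.assoc,
        ← MonoidalCategory.whiskerLeft_comp, show W' i ≫ dag (W' i) = 𝟙 _ from hW' i]
      simp
    · intro j _ hj
      rw [dag_comp, dag_tensor, MonoidalCategory.tensorHom_def', Category.assoc, ← Category.assoc,
        ← MonoidalCategory.whiskerLeft_comp, hd'.orthogonal h𝒞 hj.symm]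
      simp
    · simp
  change bend R' R = 𝟙 X
  have hlin : bend R' R = ∑ i, bend R' (S i ≫ (W' i ⊗ₘ W i)) := by
    simp only [bend, hR, whiskerLeft_sum, Preadditive.sum_comp, Preadditive.comp_sum]
  rw [hlin, ← hs]
  refine Finset.sum_congr rfl fun i _ => ?_
  calc bend R' (S i ≫ (W' i ⊗ₘ W i))
      = (ρ_ X).inv ≫ X ◁ S i ≫ (α_ X (Y' i) (Y i)).inv ≫
          (X ◁ W' i ≫ dag R') ▷ Y i ≫ (λ_ (Y i)).hom ≫ W i := by
        rw [← leftUnitor_naturality]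
        simp only [bend, MonoidalCategory.tensorHom_def, MonoidalCategory.whiskerLeft_comp, comp_whiskerRight,
          Category.assoc]
        rw [associator_inv_naturality_right_assoc, associator_inv_naturality_middle_assoc,
          whisker_exchange_assoc]
    _ = dag (W i) ≫ ((ρ_ (Y i)).inv ≫ Y i ◁ S i ≫ (α_ (Y i) (Y' i) (Y i)).inv ≫
          dag (S' i) ▷ Y i ≫ (λ_ (Y i)).hom) ≫ W i := by
        rw [key]
        simp only [comp_whiskerRight, Category.assoc]
        rw [rightUnitor_inv_naturality_assoc, ← whisker_exchange_assoc,
          associator_inv_naturality_left_assoc]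
    _ = dag (W i) ≫ W i := by rw [(hS i).2.1.1, Category.id_comp]

lemma IsStandardPair.isConjugationPair (h𝒞 : IsFiniteCStarTensorCategory 𝒞) {X X' : 𝒞}
    {R : 𝟙_ 𝒞 ⟶ X' ⊗ X} {R' : 𝟙_ 𝒞 ⟶ X ⊗ X'} (h : IsStandardPair X X' R R') :
    IsConjugationPair X X' R R' :=
  ⟨h.isConjugationPair_left h𝒞, h.symm.isConjugationPair_left h𝒞⟩

/-- A standard pair computes the canonical trace: the orthogonality of the `W'ᵢ` removes the mixed
terms, and `Wᵢ* T Wᵢ` is a scalar. -/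
lemma IsStandardPair.canTrace_left (h𝒞 : IsFiniteCStarTensorCategory 𝒞) {X X' : 𝒞}
    {R : 𝟙_ 𝒞 ⟶ X' ⊗ X} {R' : 𝟙_ 𝒞 ⟶ X ⊗ X'} (h : IsStandardPair X X' R R') (T : X ⟶ X) :
    R ≫ X' ◁ T ≫ dag R = canTrace h𝒞 X T • 𝟙 (𝟙_ 𝒞) := by
  obtain ⟨n, Y, Y', W, W', S, S', hS, hW, hW', hs, hs', hR, hR'⟩ := h
  have hd : IsDecomposition X Y W := ⟨fun i => (hS i).1, hW, hs⟩
  have hd' : IsDecomposition X' Y' W' := ⟨fun i => (hS i).symm.1, hW', hs'⟩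
  have e : ∀ i j, (S i ≫ (W' i ⊗ₘ W i)) ≫ X' ◁ T ≫ dag (S j ≫ (W' j ⊗ₘ W j)) =
      S i ≫ ((W' i ≫ dag (W' j)) ⊗ₘ (W i ≫ T ≫ dag (W j))) ≫ dag (S j) := by
    intro i j
    rw [dag_comp, dag_tensor, ← id_tensorHom, Category.assoc, tensorHom_comp_tensorHom_assoc,
      tensorHom_comp_tensorHom_assoc, Category.comp_id, Category.assoc]
  rw [← hd.trace_eq h𝒞, hd.trace_apply, hR, dag_sum, Preadditive.comp_sum, Preadditive.sum_comp,
    Finset.sum_smul]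
  refine Finset.sum_congr rfl fun i _ => ?_
  rw [Preadditive.comp_sum, Finset.sum_eq_single i]
  · rw [e, show W' i ≫ dag (W' i) = 𝟙 _ from hW' i]
    conv_lhs => rw [← (hd.irreducible i).coeff_smul (W i ≫ T ≫ dag (W i))]
    rw [id_tensorHom, MonoidalLinear.whiskerLeft_smul, Linear.smul_comp, Linear.comp_smul,
      MonoidalCategory.whiskerLeft_id, Category.id_comp, comp_dag_unit h𝒞, smul_smul,
      (hS i).irrDim_eq h𝒞, mul_comm]
  · intro j _ hj
    rw [e, hd'.orthogonal h𝒞 hj.symm, MonoidalCategory.tensorHom_def]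
    simp
  · simp

lemma IsStandardPair.canTrace_right (h𝒞 : IsFiniteCStarTensorCategory 𝒞) {X X' : 𝒞}
    {R : 𝟙_ 𝒞 ⟶ X' ⊗ X} {R' : 𝟙_ 𝒞 ⟶ X ⊗ X'} (h : IsStandardPair X X' R R') (T : X ⟶ X) :
    R' ≫ T ▷ X' ≫ dag R' = canTrace h𝒞 X T • 𝟙 (𝟙_ 𝒞) := by
  obtain ⟨n, Y, Y', W, W', S, S', hS, hW, hW', hs, hs', hR, hR'⟩ := h
  have hd : IsDecomposition X Y W := ⟨fun i => (hS i).1, hW, hs⟩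
  have hd' : IsDecomposition X' Y' W' := ⟨fun i => (hS i).symm.1, hW', hs'⟩
  have e : ∀ i j, (S' i ≫ (W i ⊗ₘ W' i)) ≫ T ▷ X' ≫ dag (S' j ≫ (W j ⊗ₘ W' j)) =
      S' i ≫ ((W i ≫ T ≫ dag (W j)) ⊗ₘ (W' i ≫ dag (W' j))) ≫ dag (S' j) := by
    intro i j
    rw [dag_comp, dag_tensor, ← tensorHom_id, Category.assoc, tensorHom_comp_tensorHom_assoc,
      tensorHom_comp_tensorHom_assoc, Category.comp_id, Category.assoc]
  rw [← hd.trace_eq h𝒞, hd.trace_apply, hR', dag_sum, Preadditive.comp_sum,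
    Preadditive.sum_comp, Finset.sum_smul]
  refine Finset.sum_congr rfl fun i _ => ?_
  rw [Preadditive.comp_sum, Finset.sum_eq_single i]
  · rw [e, show W' i ≫ dag (W' i) = 𝟙 _ from hW' i]
    conv_lhs => rw [← (hd.irreducible i).coeff_smul (W i ≫ T ≫ dag (W i))]
    rw [tensorHom_id, MonoidalLinear.smul_whiskerRight, Linear.smul_comp, Linear.comp_smul,
      id_whiskerRight, Category.id_comp, comp_dag_unit h𝒞, (hS i).normSq_eq h𝒞, smul_smul,
      (hS i).irrDim_eq h𝒞, mul_comm]
  · intro j _ hj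
    rw [e, hd'.orthogonal h𝒞 hj.symm, MonoidalCategory.tensorHom_def']
    simp
  · simp

lemma exists_standardPair (h𝒞 : IsFiniteCStarTensorCategory 𝒞) (X : 𝒞) :
    ∃ (X' : 𝒞) (R : 𝟙_ 𝒞 ⟶ X' ⊗ X) (R' : 𝟙_ 𝒞 ⟶ X ⊗ X'), IsStandardPair X X' R R' := by
  obtain ⟨n, Y, W, h⟩ := exists_decomposition h𝒞 X
  choose Y' S S' hS using fun i => exists_irredStandardPair h𝒞 (h.irreducible i)
  cases n with
  | zero => exact absurd (by simpa using h.sum_eq.symm) (id_ne_zero X)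
  | succ n =>
    obtain ⟨X', W', hW', hs'⟩ := exists_directSum h𝒞 n Y'
    exact ⟨X', _, _, n + 1, Y, Y', W, W', S, S', hS, h.isometry, hW', h.sum_eq, hs', rfl, rfl⟩

lemma statDim_eq (h𝒞 : IsFiniteCStarTensorCategory 𝒞) (X : 𝒞) :
    (statDim X : ℂ) = canTrace h𝒞 X (𝟙 X) := by
  obtain ⟨X', R, R', hR⟩ := exists_standardPair h𝒞 X
  obtain ⟨d, -, hd, -⟩ := canTrace_comp_dag h𝒞 (𝟙 X)
  rw [dag_id, Category.comp_id] at hd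
  have hex : ∃ (d : ℝ) (X' : 𝒞) (R : 𝟙_ 𝒞 ⟶ X' ⊗ X) (R' : 𝟙_ 𝒞 ⟶ X ⊗ X'),
      IsStandardPair X X' R R' ∧ R ≫ dag R = (d : ℂ) • 𝟙 (𝟙_ 𝒞) := by
    refine ⟨d, X', R, R', hR, ?_⟩
    rw [← hd, ← hR.canTrace_left h𝒞]
    simp
  rw [statDim, dif_pos hex]
  obtain ⟨X₂, R₂, R₂', hR₂, h₂⟩ := hex.choose_spec
  apply smul_id_injective (𝟙_ 𝒞)
  dsimp only
  rw [← h₂, ← hR₂.canTrace_left h𝒞]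
  simp

lemma statDim_irreducible (h𝒞 : IsFiniteCStarTensorCategory 𝒞) {Y : 𝒞} (hY : IsIrreducible Y) :
    statDim Y = irrDim Y := by
  have := statDim_eq h𝒞 Y
  rw [canTrace_irreducible h𝒞 hY, hY.coeff_id, mul_one] at this
  exact_mod_cast this

lemma statDim_pos (h𝒞 : IsFiniteCStarTensorCategory 𝒞) (X : 𝒞) : 0 < statDim X := by
  obtain ⟨r, h0, h1, h2⟩ := canTrace_comp_dag h𝒞 (𝟙 X)
  rw [dag_id, Category.comp_id, ← statDim_eq h𝒞] at h1
  have h3 : statDim X = r := by exact_mod_cast h1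
  rw [h3]
  exact lt_of_le_of_ne h0 fun h => id_ne_zero X (h2 h.symm)

lemma IsStandardPair.comp_dag_left (h𝒞 : IsFiniteCStarTensorCategory 𝒞) {X X' : 𝒞}
    {R : 𝟙_ 𝒞 ⟶ X' ⊗ X} {R' : 𝟙_ 𝒞 ⟶ X ⊗ X'} (h : IsStandardPair X X' R R') :
    R ≫ dag R = (statDim X : ℂ) • 𝟙 (𝟙_ 𝒞) := by
  rw [statDim_eq h𝒞, ← h.canTrace_left h𝒞]
  simp

lemma IsStandardPair.comp_dag_right (h𝒞 : IsFiniteCStarTensorCategory 𝒞) {X X' : 𝒞}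
    {R : 𝟙_ 𝒞 ⟶ X' ⊗ X} {R' : 𝟙_ 𝒞 ⟶ X ⊗ X'} (h : IsStandardPair X X' R R') :
    R' ≫ dag R' = (statDim X : ℂ) • 𝟙 (𝟙_ 𝒞) := by
  rw [statDim_eq h𝒞, ← h.canTrace_right h𝒞]
  simp

lemma IsStandardPair.statDim_conj (h𝒞 : IsFiniteCStarTensorCategory 𝒞) {X X' : 𝒞}
    {R : 𝟙_ 𝒞 ⟶ X' ⊗ X} {R' : 𝟙_ 𝒞 ⟶ X ⊗ X'} (h : IsStandardPair X X' R R') :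
    statDim X' = statDim X := by
  have := smul_id_injective _ ((h.symm.comp_dag_right h𝒞).symm.trans (h.comp_dag_left h𝒞))
  exact_mod_cast this

/-- The functional defining `catTrace` is the normalized canonical trace. It is determined by its
values on minimal projections, since `(X, X)` is spanned by the `Wᵢ T Wⱼ*` for a decomposition
`(Wᵢ)` of `X`, on which a trace vanishes unless `i = j`. -/
lemma isCatTrace_iff (h𝒞 : IsFiniteCStarTensorCategory 𝒞) (X : 𝒞) (t : End X →ₗ[ℂ] ℂ) :
    IsCatTrace X t ↔ ∀ T : End X, t T = (statDim X : ℂ)⁻¹ * canTrace h𝒞 X T := by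
  constructor
  · rintro ⟨htr, hmin⟩ T
    obtain ⟨n, Y, W, h⟩ := exists_decomposition h𝒞 X
    have hE : ∀ i, t (dag (W i) ≫ W i : X ⟶ X) = ((statDim (Y i) / statDim X : ℝ) : ℂ) := by
      intro i
      have hWi : W i ≫ dag (W i) = 𝟙 _ := h.isometry i
      refine hmin _ (Y i) (W i) ⟨⟨?_, ?_⟩, ?_, fun T => ?_⟩ ⟨h.isometry i, rfl⟩
      · change (dag (W i) ≫ W i) ≫ dag (W i) ≫ W i = dag (W i) ≫ W i
        rw [Category.assoc, reassoc_of% hWi]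
      · change dag (dag (W i) ≫ W i) = dag (W i) ≫ W i
        rw [dag_comp, dag_dag]
      · intro h0
        exact (h.isometry i).ne_zero (eq_zero_of_dag_comp h0)
      · obtain ⟨c, hc⟩ := h.irreducible i (W i ≫ (T : X ⟶ X) ≫ dag (W i))
        refine ⟨c, ?_⟩
        change (dag (W i) ≫ W i) ≫ (T : X ⟶ X) ≫ dag (W i) ≫ W i = c • (dag (W i) ≫ W i)
        calc (dag (W i) ≫ W i) ≫ (T : X ⟶ X) ≫ dag (W i) ≫ W i
            = dag (W i) ≫ (W i ≫ (T : X ⟶ X) ≫ dag (W i)) ≫ W i := by simp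
          _ = _ := by rw [hc]; simp
    have hT : (T : X ⟶ X) = ∑ i, (dag (W i) ≫ W i) ≫ (T : X ⟶ X) := by
      rw [← Preadditive.sum_comp, h.sum_eq, Category.id_comp]
    have hcyc : ∀ i, t ((dag (W i) ≫ W i) ≫ (T : X ⟶ X) : X ⟶ X) =
        t (dag (W i) ≫ (W i ≫ (T : X ⟶ X) ≫ dag (W i)) ≫ W i : X ⟶ X) := by
      intro i
      have hWi : W i ≫ dag (W i) = 𝟙 _ := h.isometry i
      have h1 := htr ((dag (W i) ≫ W i) ≫ (T : X ⟶ X) : X ⟶ X) (dag (W i) ≫ W i : X ⟶ X)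
      change t ((dag (W i) ≫ W i) ≫ (dag (W i) ≫ W i) ≫ (T : X ⟶ X) : X ⟶ X) =
        t (((dag (W i) ≫ W i) ≫ (T : X ⟶ X)) ≫ dag (W i) ≫ W i : X ⟶ X) at h1
      simp only [Category.assoc, reassoc_of% hWi] at h1 ⊢
      exact h1
    have hsum : t T = ∑ i, t ((dag (W i) ≫ W i) ≫ (T : X ⟶ X) : X ⟶ X) := by
      conv_lhs => rw [hT]
      exact map_sum t _ _
    rw [hsum, ← h.trace_eq h𝒞, h.trace_apply, Finset.mul_sum]
    refine Finset.sum_congr rfl fun i _ => ?_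
    rw [hcyc, ← (h.irreducible i).coeff_smul (W i ≫ (T : X ⟶ X) ≫ dag (W i)),
      (h.irreducible i).coeff_smul]
    have h2 : dag (W i) ≫ ((h.irreducible i).coeff (W i ≫ (T : X ⟶ X) ≫ dag (W i)) • 𝟙 (Y i)) ≫
        W i = (h.irreducible i).coeff (W i ≫ (T : X ⟶ X) ≫ dag (W i)) •
          (dag (W i) ≫ W i) := by simp
    rw [(h.irreducible i).coeff_smul] at h2
    rw [h2]
    refine (map_smul t _ _).trans ?_
    rw [hE, statDim_irreducible h𝒞 (h.irreducible i), smul_eq_mul, Complex.ofReal_div]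
    ring
  · intro ht
    refine ⟨fun S T => ?_, fun E Y V hE hV => ?_⟩
    · rw [ht, ht]
      congr 1
      exact canTrace_comm h𝒞 (T : X ⟶ X) (S : X ⟶ X)
    · have hV1 : V ≫ dag V = 𝟙 Y := hV.1
      have hY : IsIrreducible Y := by
        intro T
        obtain ⟨c, hc⟩ := hE.2.2 (dag V ≫ T ≫ V : X ⟶ X)
        refine ⟨c, ?_⟩
        rw [← hV.2] at hc
        replace hc : (dag V ≫ V) ≫ (dag V ≫ T ≫ V) ≫ dag V ≫ V = c • (dag V ≫ V) := hc
        have h1 := congrArg (fun A : X ⟶ X => V ≫ A ≫ dag V) hc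
        simpa [hV1, reassoc_of% hV1] using h1
      rw [ht, ← hV.2, canTrace_comm h𝒞, hV1, ← statDim_eq h𝒞, Complex.ofReal_div]
      ring

lemma catTrace_apply (h𝒞 : IsFiniteCStarTensorCategory 𝒞) (X : 𝒞) (T : End X) :
    catTrace X T = (statDim X : ℂ)⁻¹ * canTrace h𝒞 X T := by
  have hex : ∃ t : End X →ₗ[ℂ] ℂ, IsCatTrace X t :=
    ⟨(statDim X : ℂ)⁻¹ • (canTrace h𝒞 X : End X →ₗ[ℂ] ℂ),
      (isCatTrace_iff h𝒞 X _).2 fun T => rfl⟩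
  rw [catTrace, dif_pos hex]
  exact (isCatTrace_iff h𝒞 X _).1 hex.choose_spec T

lemma exists_faithfulTrace (h𝒞 : IsFiniteCStarTensorCategory 𝒞) (X : 𝒞) :
    ∃ t : FaithfulTrace (End X), t.toLinearMap = catTrace X := by
  have hd := statDim_pos h𝒞 X
  have hdc : (statDim X : ℂ) ≠ 0 := by exact_mod_cast hd.ne'
  refine ⟨⟨catTrace X, fun S T => ?_, fun S => ?_, fun S => ?_, fun S hS => ?_, ?_⟩, rfl⟩
  · rw [catTrace_apply h𝒞, catTrace_apply h𝒞]
    congr 1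
    exact canTrace_comm h𝒞 (T : X ⟶ X) (S : X ⟶ X)
  · obtain ⟨r, h0, h1, -⟩ := canTrace_comp_dag h𝒞 (S : X ⟶ X)
    rw [catTrace_apply h𝒞, show canTrace h𝒞 X (star S * S) = r from h1, ← Complex.ofReal_inv,
      ← Complex.ofReal_mul, Complex.ofReal_re]
    positivity
  · rw [catTrace_apply h𝒞, catTrace_apply h𝒞, show canTrace h𝒞 X (star S : End X) = _ from
      canTrace_dag h𝒞 (S : X ⟶ X), star_mul, star_inv₀, Complex.star_def,
      Complex.conj_ofReal, mul_comm]
  · rw [catTrace_apply h𝒞] at hS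
    exact eq_zero_of_canTrace h𝒞 ((mul_eq_zero.1 hS).resolve_left (inv_ne_zero hdc))
  · rw [catTrace_apply h𝒞, show canTrace h𝒞 X (1 : End X) = _ from (statDim_eq h𝒞 X).symm,
      inv_mul_cancel₀ hdc]

end Standard

/-! ### Partial traces and the multiplicativity of the canonical trace -/

section Product

variable {𝒞 : Type u} [Category.{v} 𝒞] [MonoidalCategory 𝒞] [CStarCategory 𝒞]

/-- The right partial trace `(XY, XY) → (X, X)`, `T ↦ (1 × R'*) (T × 1) (1 × R')`. -/
def rightPartialTrace (X : 𝒞) {Y Y' : 𝒞} (R' : 𝟙_ 𝒞 ⟶ Y ⊗ Y') (T : X ⊗ Y ⟶ X ⊗ Y) : X ⟶ X :=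
  (ρ_ X).inv ≫ X ◁ R' ≫ (α_ X Y Y').inv ≫ T ▷ Y' ≫ (α_ X Y Y').hom ≫ X ◁ dag R' ≫ (ρ_ X).hom

/-- The left partial trace `(XY, XY) → (Y, Y)`, `T ↦ (R* × 1) (1 × T) (R × 1)`. -/
def leftPartialTrace {X X' : 𝒞} (Y : 𝒞) (R : 𝟙_ 𝒞 ⟶ X' ⊗ X) (T : X ⊗ Y ⟶ X ⊗ Y) : Y ⟶ Y :=
  (λ_ Y).inv ≫ R ▷ Y ≫ (α_ X' X Y).hom ≫ X' ◁ T ≫ (α_ X' X Y).inv ≫ dag R ▷ Y ≫ (λ_ Y).hom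

/-- A closed diagram can be contracted in either order. -/
lemma partialTrace_comm {X X' Y Y' : 𝒞} (R : 𝟙_ 𝒞 ⟶ X' ⊗ X) (R' : 𝟙_ 𝒞 ⟶ Y ⊗ Y')
    (T : X ⊗ Y ⟶ X ⊗ Y) :
    R ≫ X' ◁ rightPartialTrace X R' T ≫ dag R =
      R' ≫ leftPartialTrace Y R T ▷ Y' ≫ dag R' := by
  calc R ≫ X' ◁ rightPartialTrace X R' T ≫ dag R
      = 𝟙 _ ⊗≫ (R ▷ 𝟙_ 𝒞 ≫ (X' ⊗ X) ◁ R') ⊗≫ X' ◁ T ▷ Y' ⊗≫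
          ((X' ⊗ X) ◁ dag R' ≫ dag R ▷ 𝟙_ 𝒞) ⊗≫ 𝟙 _ := by
        simp only [rightPartialTrace]; monoidal
    _ = 𝟙 _ ⊗≫ (𝟙_ 𝒞 ◁ R' ≫ R ▷ (Y ⊗ Y')) ⊗≫ X' ◁ T ▷ Y' ⊗≫
          (dag R ▷ (Y ⊗ Y') ≫ 𝟙_ 𝒞 ◁ dag R') ⊗≫ 𝟙 _ := by
        rw [whisker_exchange, whisker_exchange]
    _ = _ := by simp only [leftPartialTrace]; monoidal

/-- The product of pairs of conjugation operators. -/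
def prodPair {X X' Y Y' : 𝒞} (R : 𝟙_ 𝒞 ⟶ X' ⊗ X) (S : 𝟙_ 𝒞 ⟶ Y' ⊗ Y) :
    𝟙_ 𝒞 ⟶ (Y' ⊗ X') ⊗ (X ⊗ Y) :=
  S ≫ Y' ◁ ((λ_ Y).inv ≫ R ▷ Y ≫ (α_ X' X Y).hom) ≫ (α_ Y' X' (X ⊗ Y)).inv

/-- The product of pairs of conjugation operators, for the conjugate. -/
def prodPair' {X X' Y Y' : 𝒞} (R' : 𝟙_ 𝒞 ⟶ X ⊗ X') (S' : 𝟙_ 𝒞 ⟶ Y ⊗ Y') :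
    𝟙_ 𝒞 ⟶ (X ⊗ Y) ⊗ (Y' ⊗ X') :=
  R' ≫ ((ρ_ X).inv ≫ X ◁ S' ≫ (α_ X Y Y').inv) ▷ X' ≫ (α_ (X ⊗ Y) Y' X').hom

variable [CStarTensorCategory 𝒞]

lemma IsConjugationPair.prod {X X' Y Y' : 𝒞} {R : 𝟙_ 𝒞 ⟶ X' ⊗ X} {R' : 𝟙_ 𝒞 ⟶ X ⊗ X'}
    {S : 𝟙_ 𝒞 ⟶ Y' ⊗ Y} {S' : 𝟙_ 𝒞 ⟶ Y ⊗ Y'} (hR : IsConjugationPair X X' R R')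
    (hS : IsConjugationPair Y Y' S S') :
    IsConjugationPair (X ⊗ Y) (Y' ⊗ X') (prodPair R S) (prodPair' R' S') := by
  let := hR.exactPairing
  let := hS.exactPairing
  refine isConjugationPair_of_exactPairing ?_ ?_
  · rw [ExactPairing.tensor_coevaluation]
    change R' ⊗≫ (X ◁ S') ▷ X' ⊗≫ 𝟙 _ = _
    simp only [prodPair']; monoidal
  · rw [ExactPairing.tensor_evaluation]
    change 𝟙 _ ⊗≫ Y' ◁ (dag R ▷ Y) ⊗≫ dag S = _
    simp only [prodPair, dag_comp, dag_whiskerLeft, dag_associator, dag_associator_inv,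
      dag_leftUnitor_inv, dag_whiskerRight]
    monoidal

lemma prodPair_comp {X X' Y Y' : 𝒞} (R : 𝟙_ 𝒞 ⟶ X' ⊗ X) (S : 𝟙_ 𝒞 ⟶ Y' ⊗ Y)
    (T : X ⊗ Y ⟶ X ⊗ Y) :
    prodPair R S ≫ (Y' ⊗ X') ◁ T ≫ dag (prodPair R S) =
      S ≫ Y' ◁ leftPartialTrace Y R T ≫ dag S := by
  simp only [prodPair, leftPartialTrace, dag_comp, dag_whiskerLeft, dag_associator,
    dag_associator_inv, dag_leftUnitor_inv, dag_whiskerRight]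
  monoidal

lemma prodPair'_comp {X X' Y Y' : 𝒞} (R' : 𝟙_ 𝒞 ⟶ X ⊗ X') (S' : 𝟙_ 𝒞 ⟶ Y ⊗ Y')
    (T : X ⊗ Y ⟶ X ⊗ Y) :
    prodPair' R' S' ≫ T ▷ (Y' ⊗ X') ≫ dag (prodPair' R' S') =
      R' ≫ rightPartialTrace X S' T ▷ X' ≫ dag R' := by
  simp only [prodPair', rightPartialTrace, dag_comp, dag_whiskerLeft, dag_associator,
    dag_associator_inv, dag_rightUnitor_inv, dag_whiskerRight]
  monoidal

/-- A pair of conjugation operators whose left and right functionals agree computes the canonical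
trace. Comparison with a standard pair writes the functionals as `T ↦ tr (t T)` and
`T ↦ tr (t' T)`, where `t` and `t'` are inverse up to the involution. Hence `t = t'` is
selfadjoint and `t² = 1`, and positivity of the functional gives `t = 1`. -/
lemma IsConjugationPair.eq_canTrace (h𝒞 : IsFiniteCStarTensorCategory 𝒞) {Z Z' : 𝒞}
    {Q : 𝟙_ 𝒞 ⟶ Z' ⊗ Z} {Q' : 𝟙_ 𝒞 ⟶ Z ⊗ Z'} (hQ : IsConjugationPair Z Z' Q Q')
    (h : ∀ T : Z ⟶ Z, Q ≫ Z' ◁ T ≫ dag Q = Q' ≫ T ▷ Z' ≫ dag Q') (T : Z ⟶ Z) :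
    Q ≫ Z' ◁ T ≫ dag Q = canTrace h𝒞 Z T • 𝟙 (𝟙_ 𝒞) := by
  obtain ⟨X', R, R', hR⟩ := exists_standardPair h𝒞 Z
  obtain ⟨t, t', htt, h1, h2⟩ := exists_comparison (hR.isConjugationPair h𝒞) hQ
  have hfaith : ∀ a b : Z ⟶ Z, (∀ T, canTrace h𝒞 Z (a ≫ T) = canTrace h𝒞 Z (b ≫ T)) → a = b := by
    intro a b hab
    apply sub_eq_zero.1
    apply eq_zero_of_canTrace h𝒞
    rw [Preadditive.sub_comp, map_sub, hab, sub_self]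
  have hφ : ∀ T, Q ≫ Z' ◁ T ≫ dag Q = canTrace h𝒞 Z (t ≫ T) • 𝟙 (𝟙_ 𝒞) := fun T => by
    rw [h1, hR.canTrace_left h𝒞]
  have htt' : t = t' := by
    refine hfaith _ _ fun T => smul_id_injective (𝟙_ 𝒞) ?_
    dsimp only
    rw [← hφ, h, h2, hR.canTrace_right h𝒞]
  subst htt'
  have hdag : dag t = t := by
    refine hfaith _ _ fun T => ?_
    have e1 : canTrace h𝒞 Z (t ≫ dag T) • 𝟙 (𝟙_ 𝒞) =
        star (canTrace h𝒞 Z (t ≫ T)) • 𝟙 (𝟙_ 𝒞) := by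
      rw [← hφ, ← dag_id, ← dag_smul, ← hφ]
      simp [dag_comp]
    have e2 : canTrace h𝒞 Z (t ≫ dag T) = star (canTrace h𝒞 Z (t ≫ T)) :=
      smul_id_injective _ e1
    rw [← canTrace_dag h𝒞, dag_comp] at e2
    have e3 : canTrace h𝒞 Z (t ≫ T) = star (canTrace h𝒞 Z (t ≫ dag T)) := by
      rw [e2, ← canTrace_dag h𝒞, dag_comp, dag_dag, dag_dag]
    rw [e3, ← canTrace_dag h𝒞, dag_comp, dag_dag, canTrace_comm h𝒞]
  rw [hdag] at htt
  have ht1 : t = 𝟙 Z := by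
    set s : Z ⟶ Z := t - 𝟙 Z with hs
    have hts : t ≫ s = -s := by
      rw [hs, Preadditive.comp_sub, htt, Category.comp_id, neg_sub]
    -- the functional is nonnegative on `s* ∘ s`, and equal there to `- tr (s* ∘ s)`
    have e1 : Q ≫ Z' ◁ (s ≫ dag s) ≫ dag Q =
        ((‖Q ≫ Z' ◁ s‖ ^ 2 : ℝ) : ℂ) • 𝟙 (𝟙_ 𝒞) := by
      rw [← comp_dag_unit h𝒞]
      simp [dag_comp]
    obtain ⟨r, hr0, hr, hr1⟩ := canTrace_comp_dag h𝒞 s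
    rw [hφ, ← Category.assoc, hts, Preadditive.neg_comp, map_neg, hr] at e1
    have e2 : -(r : ℂ) = ((‖Q ≫ Z' ◁ s‖ ^ 2 : ℝ) : ℂ) := smul_id_injective _ e1
    have e3 : -r = ‖Q ≫ Z' ◁ s‖ ^ 2 := by exact_mod_cast e2
    exact sub_eq_zero.1 (hr1 (le_antisymm (by nlinarith [sq_nonneg ‖Q ≫ Z' ◁ s‖]) hr0))
  rw [hφ, ht1, Category.id_comp]

/-- The canonical trace of `XY` is the canonical trace of `X` after the right partial trace, and
that of `Y` after the left partial trace: both composites come from the product of two standard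
pairs, and they agree because a closed diagram can be contracted in either order. -/
lemma canTrace_tensor (h𝒞 : IsFiniteCStarTensorCategory 𝒞) {X X' Y Y' : 𝒞}
    {R : 𝟙_ 𝒞 ⟶ X' ⊗ X} {R' : 𝟙_ 𝒞 ⟶ X ⊗ X'} {S : 𝟙_ 𝒞 ⟶ Y' ⊗ Y} {S' : 𝟙_ 𝒞 ⟶ Y ⊗ Y'}
    (hR : IsStandardPair X X' R R') (hS : IsStandardPair Y Y' S S') (T : X ⊗ Y ⟶ X ⊗ Y) :
    canTrace h𝒞 (X ⊗ Y) T = canTrace h𝒞 X (rightPartialTrace X S' T) ∧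
      canTrace h𝒞 (X ⊗ Y) T = canTrace h𝒞 Y (leftPartialTrace Y R T) := by
  have hLR : ∀ T : X ⊗ Y ⟶ X ⊗ Y, canTrace h𝒞 X (rightPartialTrace X S' T) =
      canTrace h𝒞 Y (leftPartialTrace Y R T) := fun T => smul_id_injective (𝟙_ 𝒞) (by
    dsimp only
    rw [← hR.canTrace_left h𝒞, ← hS.canTrace_right h𝒞, partialTrace_comm])
  have hprod := (hR.isConjugationPair h𝒞).prod (hS.isConjugationPair h𝒞)
  have h1 := hprod.eq_canTrace h𝒞 (fun T => by
    rw [prodPair_comp, prodPair'_comp, hS.canTrace_left h𝒞, hR.canTrace_right h𝒞, hLR]) T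
  rw [prodPair_comp, hS.canTrace_left h𝒞] at h1
  have h2 : canTrace h𝒞 (X ⊗ Y) T = canTrace h𝒞 Y (leftPartialTrace Y R T) :=
    (smul_id_injective _ h1).symm
  exact ⟨h2.trans (hLR T).symm, h2⟩

lemma canTrace_rightPartialTrace (h𝒞 : IsFiniteCStarTensorCategory 𝒞) (X : 𝒞) {Y Y' : 𝒞}
    {S : 𝟙_ 𝒞 ⟶ Y' ⊗ Y} {S' : 𝟙_ 𝒞 ⟶ Y ⊗ Y'} (hS : IsStandardPair Y Y' S S')
    (T : X ⊗ Y ⟶ X ⊗ Y) :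
    canTrace h𝒞 X (rightPartialTrace X S' T) = canTrace h𝒞 (X ⊗ Y) T := by
  obtain ⟨X', R, R', hR⟩ := exists_standardPair h𝒞 X
  exact (canTrace_tensor h𝒞 hR hS T).1.symm

lemma canTrace_leftPartialTrace (h𝒞 : IsFiniteCStarTensorCategory 𝒞) {X X' : 𝒞} (Y : 𝒞)
    {R : 𝟙_ 𝒞 ⟶ X' ⊗ X} {R' : 𝟙_ 𝒞 ⟶ X ⊗ X'} (hR : IsStandardPair X X' R R')
    (T : X ⊗ Y ⟶ X ⊗ Y) :
    canTrace h𝒞 Y (leftPartialTrace Y R T) = canTrace h𝒞 (X ⊗ Y) T := by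
  obtain ⟨Y', S, S', hS⟩ := exists_standardPair h𝒞 Y
  exact (canTrace_tensor h𝒞 hR hS T).2.symm

end Product

/-! ### Inclusions of endomorphism algebras and the basic construction -/

lemma L2.clm_ext {B : Type w} [Ring B] [StarRing B] [Algebra ℂ B] [StarModule ℂ B]
    {t : FaithfulTrace B} {S T : L2 t →L[ℂ] L2 t}
    (h : ∀ b : B, S (L2.of t b) = T (L2.of t b)) : S = T :=
  ContinuousLinearMap.ext fun x => h ((L2.of t).symm x)

section Projection

variable {𝒞 : Type u} [Category.{v} 𝒞] [CStarCategory 𝒞] {X Q : 𝒞} {v : X ⟶ Q} {d : ℝ}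

/-- The endomorphism `v v* / d`, which is the range projection of `v` when `v* v = d`. -/
def frobProj (v : X ⟶ Q) (d : ℝ) : End Q := ((d : ℂ)⁻¹ • (dag v ≫ v) : Q ⟶ Q)

lemma frobProj_comp (c : Q ⟶ Q) :
    (frobProj v d : Q ⟶ Q) ≫ c = (d : ℂ)⁻¹ • (dag v ≫ v ≫ c) := by
  change ((d : ℂ)⁻¹ • (dag v ≫ v)) ≫ c = _
  rw [Linear.smul_comp, Category.assoc]

lemma star_frobProj : star (frobProj v d) = frobProj v d := by
  change dag ((d : ℂ)⁻¹ • (dag v ≫ v)) = (d : ℂ)⁻¹ • (dag v ≫ v)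
  rw [dag_smul, dag_comp, dag_dag, star_inv₀, Complex.star_def, Complex.conj_ofReal]

variable {B : Type*} [Ring B] [StarRing B] [Algebra ℂ B] {j : B →⋆ₐ[ℂ] End Q}

lemma incl_mul_frobProj_mem_spanBfB (b : B) :
    j b * frobProj v d ∈ spanBfB j (frobProj v d) :=
  Submodule.subset_span ⟨b, 1, by rw [map_one, mul_one]⟩

lemma frobProj_mem_spanBfB : frobProj v d ∈ spanBfB j (frobProj v d) :=
  Submodule.subset_span ⟨1, 1, by rw [map_one, mul_one, one_mul]⟩

lemma star_mem_spanBfB {x : End Q}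
    (hx : x ∈ spanBfB j (frobProj v d)) :
    star x ∈ spanBfB j (frobProj v d) := by
  induction hx using Submodule.span_induction with
  | mem x hx =>
    obtain ⟨b₁, b₂, rfl⟩ := hx
    refine Submodule.subset_span ⟨star b₂, star b₁, ?_⟩
    rw [star_mul, star_mul, star_frobProj, map_star, map_star, mul_assoc]
  | zero => rw [star_zero]; exact Submodule.zero_mem _
  | add x y _ _ hx hy => rw [star_add]; exact Submodule.add_mem _ hx hy
  | smul r x _ hx => rw [star_smul]; exact Submodule.smul_mem _ _ hx

end Projection

section Inclusion

variable {𝒞 : Type u} [Category.{v} 𝒞] [MonoidalCategory 𝒞] [CStarCategory 𝒞]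
  [CStarTensorCategory 𝒞]

/-- What the two situations `ρ, ρσ, ρσσ'` and `ρ, σρ, σ'σρ` have in common: objects `X`, `P`, `Q`
with inclusions `i` of `(X, X)` into `(P, P)` and `j` of `(P, P)` into `(Q, Q)`, and
`v ∈ (X, Q)` (namely `1 × R'`, respectively `R × 1`) for which `b ↦ j b ∘ v` is a bijection of
`(P, P)` onto `(X, Q)` that intertwines the traces. The number `d` is the dimension of `σ`. -/
structure IsFrobeniusInclusion (h𝒞 : IsFiniteCStarTensorCategory 𝒞) {X P Q : 𝒞}
    (i : End X →⋆ₐ[ℂ] End P) (j : End P →⋆ₐ[ℂ] End Q) (v : X ⟶ Q) (d : ℝ) : Prop where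
  pos : 0 < d
  bijective : Function.Bijective (fun b : End P => v ≫ (j b : Q ⟶ Q))
  comp_incl : ∀ a : End X, v ≫ (j (i a) : Q ⟶ Q) = (a : X ⟶ X) ≫ v
  comp_dag : v ≫ dag v = (d : ℂ) • 𝟙 X
  trace : ∀ b : End P, canTrace h𝒞 X (v ≫ (j b : Q ⟶ Q) ≫ dag v) = canTrace h𝒞 P b
  statDim_eq : statDim Q = d * statDim P

namespace IsFrobeniusInclusion

variable {h𝒞 : IsFiniteCStarTensorCategory 𝒞} {X P Q : 𝒞} {i : End X →⋆ₐ[ℂ] End P}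
  {j : End P →⋆ₐ[ℂ] End Q} {v : X ⟶ Q} {d : ℝ}

lemma ne_zero (H : IsFrobeniusInclusion h𝒞 i j v d) : (d : ℂ) ≠ 0 := by exact_mod_cast H.pos.ne'

lemma comp_frobProj (H : IsFrobeniusInclusion h𝒞 i j v d) : v ≫ (frobProj v d : Q ⟶ Q) = v := by
  change v ≫ ((d : ℂ)⁻¹ • (dag v ≫ v)) = v
  rw [Linear.comp_smul, ← Category.assoc, H.comp_dag, Linear.smul_comp, Category.id_comp,
    smul_smul, inv_mul_cancel₀ H.ne_zero, one_smul]

lemma markov (H : IsFrobeniusInclusion h𝒞 i j v d) (b : End P) :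
    catTrace Q (j b * frobProj v d) = 1 / (d : ℂ) ^ 2 * catTrace P b := by
  have hP : (statDim P : ℂ) ≠ 0 := by exact_mod_cast (statDim_pos h𝒞 P).ne'
  have h1 : canTrace h𝒞 Q (j b * frobProj v d : End Q) = (d : ℂ)⁻¹ * canTrace h𝒞 P b := by
    change canTrace h𝒞 Q ((frobProj v d : Q ⟶ Q) ≫ (j b : Q ⟶ Q)) = _
    rw [frobProj_comp, map_smul, canTrace_comm h𝒞, Category.assoc, H.trace, smul_eq_mul]
  rw [catTrace_apply h𝒞, catTrace_apply h𝒞, h1, H.statDim_eq, Complex.ofReal_mul]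
  have := H.ne_zero
  field_simp

variable (H : IsFrobeniusInclusion h𝒞 i j v d)

/-- Frobenius reciprocity as a linear equivalence. -/
def equiv : End P ≃ₗ[ℂ] (X ⟶ Q) :=
  LinearEquiv.ofBijective
    { toFun := fun b => v ≫ (j b : Q ⟶ Q)
      map_add' := fun a b => by
        rw [map_add]; exact Preadditive.comp_add _ _ _ _ _ _
      map_smul' := fun c b => by
        rw [map_smul]; exact Linear.comp_smul _ _ _ _ _ _ } H.bijective

lemma equiv_apply (b : End P) : H.equiv b = v ≫ (j b : Q ⟶ Q) := rfl

lemma equiv_mul (a b : End P) : H.equiv (a * b) = H.equiv b ≫ (j a : Q ⟶ Q) := by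
  rw [equiv_apply, map_mul, equiv_apply, Category.assoc]
  rfl

/-- `(Q, Q)` acts on `(P, P) ≅ (X, Q)` by composition. -/
def action (c : End Q) : End P →ₗ[ℂ] End P where
  toFun b := H.equiv.symm (H.equiv b ≫ (c : Q ⟶ Q))
  map_add' a b := by rw [map_add, Preadditive.add_comp, map_add]
  map_smul' r b := by
    rw [map_smul, Linear.smul_comp, map_smul, RingHom.id_apply]

lemma equiv_action (c : End Q) (b : End P) :
    H.equiv (H.action c b) = H.equiv b ≫ (c : Q ⟶ Q) := H.equiv.apply_symm_apply _

lemma inner_eq {t : FaithfulTrace (End P)} (ht : t.toLinearMap = catTrace P) (a b : End P) :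
    inner ℂ (L2.of t a) (L2.of t b) =
      (statDim P : ℂ)⁻¹ * canTrace h𝒞 X (H.equiv b ≫ dag (H.equiv a)) := by
  change t.toLinearMap (star a * b) = _
  rw [ht, catTrace_apply h𝒞, ← H.trace, map_mul, map_star, equiv_apply, equiv_apply, dag_comp,
    Category.assoc]
  change _ * canTrace h𝒞 X (v ≫ ((j b : Q ⟶ Q) ≫ dag (j a : Q ⟶ Q)) ≫ dag v) = _
  rw [Category.assoc]

variable [FiniteDimensional ℂ (End P)] (t : FaithfulTrace (End P))

/-- The action of `(Q, Q)` on `L²(P, P)`. -/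
def rep (c : End Q) : L2 t →L[ℂ] L2 t :=
  LinearMap.toContinuousLinearMap ((L2.of t).conj (H.action c))

lemma rep_of (c : End Q) (b : End P) : H.rep t c (L2.of t b) = L2.of t (H.action c b) := rfl

lemma rep_mul (c c' : End Q) : H.rep t (c * c') = H.rep t c * H.rep t c' := by
  refine L2.clm_ext fun b => ?_
  change _ = H.rep t c (H.rep t c' (L2.of t b))
  rw [rep_of, rep_of, rep_of]
  congr 1
  apply H.equiv.injective
  rw [equiv_action, equiv_action, equiv_action, Category.assoc]
  rfl

lemma rep_add (c c' : End Q) : H.rep t (c + c') = H.rep t c + H.rep t c' := by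
  refine L2.clm_ext fun b => ?_
  change _ = H.rep t c (L2.of t b) + H.rep t c' (L2.of t b)
  rw [rep_of, rep_of, rep_of, ← map_add]
  congr 1
  apply H.equiv.injective
  rw [equiv_action, map_add, equiv_action, equiv_action]
  exact Preadditive.comp_add _ _ _ _ _ _

lemma rep_zero : H.rep t 0 = 0 := by
  have h := H.rep_add t 0 0
  rwa [add_zero, left_eq_add] at h

lemma rep_sub (c c' : End Q) : H.rep t (c - c') = H.rep t c - H.rep t c' :=
  eq_sub_of_add_eq (by rw [← rep_add, sub_add_cancel])

lemma rep_smul (r : ℂ) (c : End Q) : H.rep t (r • c) = r • H.rep t c := by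
  refine L2.clm_ext fun b => ?_
  change _ = r • H.rep t c (L2.of t b)
  rw [rep_of, rep_of, ← map_smul]
  congr 1
  apply H.equiv.injective
  rw [equiv_action, map_smul, equiv_action]
  exact Linear.comp_smul _ _ _ _ _ _

lemma rep_star (ht : t.toLinearMap = catTrace P) (c : End Q) :
    H.rep t (star c) = star (H.rep t c) := by
  rw [ContinuousLinearMap.star_eq_adjoint, ContinuousLinearMap.eq_adjoint_iff]
  intro x y
  obtain ⟨a, rfl⟩ := (L2.of t).surjective x
  obtain ⟨b, rfl⟩ := (L2.of t).surjective y
  change inner ℂ (L2.of t (H.action (star c) a)) (L2.of t b) =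
    inner ℂ (L2.of t a) (L2.of t (H.action c b))
  rw [H.inner_eq ht, H.inner_eq ht, equiv_action, equiv_action, dag_comp,
    Category.assoc]
  congr 3
  congr 1
  exact dag_dag (c : Q ⟶ Q)

lemma rep_incl (b : End P) : H.rep t (j b) = leftMul t b := by
  refine L2.clm_ext fun a => ?_
  rw [rep_of]
  change L2.of t (H.action (j b) a) = L2.of t (b * a)
  congr 1
  apply H.equiv.injective
  rw [equiv_action, equiv_mul]

/-- The conditional expectation onto `(X, X)` is `b ↦ d⁻¹ v* (j b) v`. -/
lemma rep_frobProj (ht : t.toLinearMap = catTrace P) :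
    H.rep t (frobProj v d) = jonesProj i.range t := by
  refine L2.clm_ext fun b => ?_
  set a : End X := ((d : ℂ)⁻¹ • (H.equiv b ≫ dag v) : X ⟶ X) with ha
  have hia : ∀ a : End X, H.equiv (i a) = (a : X ⟶ X) ≫ v := fun a => H.comp_incl a
  have h1 : H.action (frobProj v d) b = i a := by
    apply H.equiv.injective
    rw [equiv_action, hia, ha]
    change H.equiv b ≫ ((d : ℂ)⁻¹ • (dag v ≫ v)) = ((d : ℂ)⁻¹ • (H.equiv b ≫ dag v)) ≫ v
    rw [Linear.comp_smul, Linear.smul_comp, Category.assoc]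
  refine (Submodule.eq_starProjection_of_mem_of_inner_eq_zero ?_ ?_).symm
  · rw [rep_of, h1]
    exact ⟨i a, ⟨a, rfl⟩, rfl⟩
  · rintro _ ⟨_, ⟨a', rfl⟩, rfl⟩
    rw [rep_of, inner_sub_left, sub_eq_zero]
    change inner ℂ (L2.of t b) (L2.of t (i a')) =
      inner ℂ (L2.of t (H.action (frobProj v d) b)) (L2.of t (i a'))
    rw [H.inner_eq ht, H.inner_eq ht, h1, hia, hia, ha, Category.assoc, Category.assoc]
    congr 3
    rw [dag_comp, dag_smul, dag_comp, dag_dag, Linear.comp_smul, Linear.comp_smul,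
      ← Category.assoc v (dag v), H.comp_dag, star_inv₀, Complex.star_def, Complex.conj_ofReal,
      Linear.smul_comp, smul_smul, inv_mul_cancel₀ H.ne_zero, one_smul, Category.id_comp]

end IsFrobeniusInclusion

end Inclusion

/-! ### The ideal `span BfB` -/

section Ideal

variable {𝒞 : Type u} [Category.{v} 𝒞] [MonoidalCategory 𝒞] [CStarCategory 𝒞]
  [CStarTensorCategory 𝒞]

namespace IsFrobeniusInclusion

variable {h𝒞 : IsFiniteCStarTensorCategory 𝒞} {X P Q : 𝒞} {i : End X →⋆ₐ[ℂ] End P}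
  {j : End P →⋆ₐ[ℂ] End Q} {v : X ⟶ Q} {d : ℝ}

/-- `C f B` is contained in `B f`: the element `c (j b) v` is of the form `(j b') v`. -/
lemma mul_incl_mul_frobProj (H : IsFrobeniusInclusion h𝒞 i j v d) (c : End Q) (b : End P) :
    c * (j b * frobProj v d) = j (H.action c b) * frobProj v d := by
  change ((frobProj v d : Q ⟶ Q) ≫ (j b : Q ⟶ Q)) ≫ (c : Q ⟶ Q) =
    (frobProj v d : Q ⟶ Q) ≫ (j (H.action c b) : Q ⟶ Q)
  rw [frobProj_comp, frobProj_comp, ← equiv_apply H, ← equiv_apply H, equiv_action,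
    Linear.smul_comp, Category.assoc]

lemma mul_mem_spanBfB (H : IsFrobeniusInclusion h𝒞 i j v d) (c : End Q) {x : End Q}
    (hx : x ∈ spanBfB j (frobProj v d)) :
    c * x ∈ spanBfB j (frobProj v d) := by
  induction hx using Submodule.span_induction with
  | mem x hx =>
    obtain ⟨b₁, b₂, rfl⟩ := hx
    rw [← mul_assoc, H.mul_incl_mul_frobProj]
    exact Submodule.subset_span ⟨_, _, rfl⟩
  | zero => rw [mul_zero]; exact Submodule.zero_mem _
  | add x y _ _ hx hy => rw [mul_add]; exact Submodule.add_mem _ hx hy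
  | smul r x _ hx => rw [mul_smul_comm]; exact Submodule.smul_mem _ _ hx

lemma mem_spanBfB_mul (H : IsFrobeniusInclusion h𝒞 i j v d) (c : End Q) {x : End Q}
    (hx : x ∈ spanBfB j (frobProj v d)) :
    x * c ∈ spanBfB j (frobProj v d) := by
  rw [← star_star (x * c), star_mul]
  exact star_mem_spanBfB (H.mul_mem_spanBfB _ (star_mem_spanBfB hx))

/-- The ideal `D` has a left unit `p`: the adjoint of the orthogonal projection of `1` to `D` in
`L²(Q, Q)`, as `1 - p*` is orthogonal to the ideal `D`, so that `y = (1 - p) x ∈ D` satisfies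
`tr (y* y) = 0` for `x ∈ D`. -/
lemma exists_left_unit (H : IsFrobeniusInclusion h𝒞 i j v d) :
    ∃ p ∈ spanBfB j (frobProj v d),
    ∀ x ∈ spanBfB j (frobProj v d), p * x = x := by
  have := finiteDimensional_end h𝒞 Q
  obtain ⟨t, -⟩ := exists_faithfulTrace h𝒞 Q
  let K : Submodule ℂ (L2 t) := (spanBfB j (frobProj v d)).map (L2.of t : End Q →ₗ[ℂ] L2 t)
  obtain ⟨p, hp, hpe⟩ : K.starProjection (L2.of t 1) ∈ K := K.starProjection_apply_mem _
  refine ⟨star p, star_mem_spanBfB hp, fun x hx => ?_⟩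
  have horth : ∀ y ∈ spanBfB j (frobProj v d), t.toLinearMap (star (1 - p) * y) = 0 := by
    intro y hy
    have h1 : inner ℂ (L2.of t 1 - K.starProjection (L2.of t 1)) (L2.of t y) = 0 :=
      K.starProjection_inner_eq_zero _ _ ⟨y, hy, rfl⟩
    rw [← hpe] at h1
    exact h1
  set y : End Q := star (1 - p) * x with hy
  have hyD : y ∈ spanBfB j (frobProj v d) := H.mul_mem_spanBfB _ hx
  have h0 : y = 0 := by
    rw [← star_star y]
    rw [t.faithful (star y) (by
      rw [star_star]
      conv_lhs => rw [hy]
      rw [mul_assoc]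
      exact horth _ (H.mul_mem_spanBfB _ (star_mem_spanBfB hyD))), star_zero]
  rw [hy, star_sub, star_one, sub_mul, one_mul, sub_eq_zero] at h0
  exact h0.symm

lemma equiv_comp_left_unit (H : IsFrobeniusInclusion h𝒞 i j v d) {p : End Q}
    (hp : ∀ x ∈ spanBfB j (frobProj v d), p * x = x) (b : End P) :
    H.equiv b ≫ (p : Q ⟶ Q) = H.equiv b := by
  have h1 : ((frobProj v d : Q ⟶ Q) ≫ (j b : Q ⟶ Q)) ≫ (p : Q ⟶ Q) =
      (frobProj v d : Q ⟶ Q) ≫ (j b : Q ⟶ Q) := hp _ (incl_mul_frobProj_mem_spanBfB b)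
  have h2 : H.equiv b = v ≫ (frobProj v d : Q ⟶ Q) ≫ (j b : Q ⟶ Q) := by
    rw [← Category.assoc, H.comp_frobProj, equiv_apply]
  rw [h2, Category.assoc, h1]

/-- If every irreducible subobject of `Q` is a subobject of `X`, then the morphisms from `X`
generate `Q`, on which the unit of `D` is therefore the identity. -/
lemma spanBfB_eq_top (H : IsFrobeniusInclusion h𝒞 i j v d)
    (hX : ∀ π : 𝒞, IsIrreducible π → IsSubobject π Q → IsSubobject π X) :
    spanBfB j (frobProj v d) = ⊤ := by
  obtain ⟨p, hpD, hp⟩ := H.exists_left_unit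
  have hp1 : (p : Q ⟶ Q) = 𝟙 Q := by
    obtain ⟨n, Y, W, hW⟩ := exists_decomposition h𝒞 Q
    rw [← Category.id_comp (p : Q ⟶ Q), ← hW.sum_eq, Preadditive.sum_comp]
    refine Finset.sum_congr rfl fun k _ => ?_
    obtain ⟨_, V, hV, -⟩ := hX (Y k) (hW.irreducible k) ⟨_, W k, hW.isometry k, rfl⟩
    have h1 : W k = V ≫ dag V ≫ W k := by
      rw [← Category.assoc, show V ≫ dag V = 𝟙 _ from hV, Category.id_comp]
    obtain ⟨b, hb⟩ := H.equiv.surjective (dag V ≫ W k)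
    have h2 : W k ≫ (p : Q ⟶ Q) = W k := by
      rw [h1, ← hb, Category.assoc, H.equiv_comp_left_unit hp]
    rw [Category.assoc, h2]
  rw [eq_top_iff]
  intro c _
  rw [← mul_one c, show (1 : End Q) = p from hp1.symm]
  exact H.mul_mem_spanBfB c hpD

section Representation

variable (H : IsFrobeniusInclusion h𝒞 i j v d) [FiniteDimensional ℂ (End P)]
  (t : FaithfulTrace (End P))

/-- The action of `(Q, Q)` on `L²(P, P)` is faithful on `D`. -/
lemma eq_zero_of_rep {x : End Q} (hx : x ∈ spanBfB j (frobProj v d)) (h : H.rep t x = 0) :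
    x = 0 := by
  have h1 : ∀ b : End P, v ≫ (j b : Q ⟶ Q) ≫ (x : Q ⟶ Q) = 0 := by
    intro b
    have h2 : H.rep t x (L2.of t b) = 0 := by rw [h]; rfl
    rw [rep_of, map_eq_zero_iff _ (L2.of t).injective] at h2
    rw [← Category.assoc, ← equiv_apply H, ← equiv_action, h2, map_zero]
  have h2 : ∀ y ∈ spanBfB j (frobProj v d), x * y = 0 := by
    intro y hy
    induction hy using Submodule.span_induction with
    | mem y hy =>
      obtain ⟨b₁, b₂, rfl⟩ := hy
      have h3 : x * (j b₁ * frobProj v d) = 0 := by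
        change ((frobProj v d : Q ⟶ Q) ≫ (j b₁ : Q ⟶ Q)) ≫ (x : Q ⟶ Q) = 0
        rw [Category.assoc, frobProj_comp, h1, Limits.comp_zero, smul_zero]
      rw [← mul_assoc, h3, zero_mul]
    | zero => rw [mul_zero]
    | add y z _ _ hy hz => rw [mul_add, hy, hz, add_zero]
    | smul r y _ hy => rw [mul_smul_comm, hy, smul_zero]
  exact eq_zero_of_dag_comp (f := (x : Q ⟶ Q)) (h2 (star x) (star_mem_spanBfB hx))

lemma rep_injOn {x y : End Q} (hx : x ∈ spanBfB j (frobProj v d))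
    (hy : y ∈ spanBfB j (frobProj v d)) (h : H.rep t x = H.rep t y) : x = y := by
  apply sub_eq_zero.1
  refine H.eq_zero_of_rep t (Submodule.sub_mem _ hx hy) ?_
  rw [rep_sub, h, sub_self]

lemma rep_left_unit {p : End Q}
    (hp : ∀ x ∈ spanBfB j (frobProj v d), p * x = x) : H.rep t p = 1 := by
  refine L2.clm_ext fun b => ?_
  rw [rep_of]
  change L2.of t (H.action p b) = L2.of t b
  congr 1
  apply H.equiv.injective
  rw [equiv_action, H.equiv_comp_left_unit hp]

lemma rep_mem (ht : t.toLinearMap = catTrace P) {x : End Q}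
    (hx : x ∈ spanBfB j (frobProj v d)) : H.rep t x ∈ basicConstruction i.range t := by
  induction hx using Submodule.span_induction with
  | mem x hx =>
    obtain ⟨b₁, b₂, rfl⟩ := hx
    rw [rep_mul, rep_mul, rep_incl, rep_incl, H.rep_frobProj t ht]
    exact mul_mem (mul_mem (basicConstruction.of _ t b₁).2 (basicConstruction.jones _ t).2)
      (basicConstruction.of _ t b₂).2
  | zero =>
    rw [rep_zero]
    exact zero_mem _
  | add x y _ _ hx hy => rw [rep_add]; exact add_mem hx hy
  | smul r x _ hx => rw [rep_smul]; exact SMulMemClass.smul_mem r hx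

/-- The basic construction is the image of `D`: this image contains the Jones projection, and,
as `D` is an ideal with a unit acting as `1`, the left multiplications. -/
lemma exists_rep_eq (ht : t.toLinearMap = catTrace P) {T : L2 t →L[ℂ] L2 t}
    (hT : T ∈ basicConstruction i.range t) :
    ∃ x ∈ spanBfB j (frobProj v d), H.rep t x = T := by
  obtain ⟨p, hpD, hp⟩ := H.exists_left_unit
  let S : StarSubalgebra ℂ (L2 t →L[ℂ] L2 t) :=
    { carrier := {T | ∃ x ∈ spanBfB j (frobProj v d), H.rep t x = T}
      mul_mem' := by
        rintro _ _ ⟨x, hx, rfl⟩ ⟨y, hy, rfl⟩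
        exact ⟨x * y, H.mul_mem_spanBfB x hy, H.rep_mul t x y⟩
      add_mem' := by
        rintro _ _ ⟨x, hx, rfl⟩ ⟨y, hy, rfl⟩
        exact ⟨x + y, Submodule.add_mem _ hx hy, H.rep_add t x y⟩
      algebraMap_mem' := fun r => ⟨r • p, Submodule.smul_mem _ _ hpD, by
        rw [rep_smul, H.rep_left_unit t hp, Algebra.algebraMap_eq_smul_one]⟩
      star_mem' := by
        rintro _ ⟨x, hx, rfl⟩
        exact ⟨star x, star_mem_spanBfB hx, H.rep_star t ht x⟩ }
  have hle : basicConstruction i.range t ≤ S := by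
    refine StarAlgebra.adjoin_le ?_
    rintro _ (⟨b, rfl⟩ | rfl)
    · refine ⟨j b * p, H.mul_mem_spanBfB _ hpD, ?_⟩
      rw [rep_mul, rep_incl, H.rep_left_unit t hp, mul_one]
    · exact ⟨frobProj v d, frobProj_mem_spanBfB, H.rep_frobProj t ht⟩
  exact hle hT

/-- The isomorphism of the basic construction with `D`, inverse to the action on `L²(P, P)`. -/
theorem exists_iso (H : IsFrobeniusInclusion h𝒞 i j v d) (ht : t.toLinearMap = catTrace P) :
    ∃ α : basicConstruction i.range t →⋆ₙₐ[ℂ] End Q,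
      Function.Injective α ∧
      Set.range α = (spanBfB j (frobProj v d) : Set (End Q)) ∧
      α (basicConstruction.jones _ t) = frobProj v d ∧
      (∀ (b : End P) (T : basicConstruction i.range t),
        α (basicConstruction.of _ t b * T) = j b * α T ∧
        α (T * basicConstruction.of _ t b) = α T * j b) ∧
      ((∀ π : 𝒞, IsIrreducible π → IsSubobject π Q → IsSubobject π X) →
        spanBfB j (frobProj v d) = ⊤ ∧
        ∀ b : End P, α (basicConstruction.of _ t b) = j b) := by
  choose α hα hrep using fun T : basicConstruction i.range t => H.exists_rep_eq t ht T.2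
  have huniq : ∀ (T : basicConstruction i.range t) {x : End Q},
      x ∈ spanBfB j (frobProj v d) → H.rep t x = T → α T = x := fun T x hx h =>
    H.rep_injOn t (hα T) hx ((hrep T).trans h.symm)
  let φ : basicConstruction i.range t →⋆ₙₐ[ℂ] End Q :=
    { toFun := α
      map_smul' := fun r T => huniq _ (Submodule.smul_mem _ _ (hα T)) (by
        rw [rep_smul, hrep]; rfl)
      map_zero' := huniq _ (Submodule.zero_mem _) (by
        rw [rep_zero]; rfl)
      map_add' := fun S T => huniq _ (Submodule.add_mem _ (hα S) (hα T)) (by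
        rw [rep_add, hrep, hrep]; rfl)
      map_mul' := fun S T => huniq _ (H.mul_mem_spanBfB _ (hα T)) (by
        rw [rep_mul, hrep, hrep]; rfl)
      map_star' := fun T => huniq _ (star_mem_spanBfB (hα T)) (by
        rw [H.rep_star t ht, hrep]; rfl) }
  refine ⟨φ, fun S T h => ?_, ?_, huniq _ frobProj_mem_spanBfB (H.rep_frobProj t ht), fun b T =>
    ⟨huniq _ (H.mul_mem_spanBfB _ (hα T)) ?_, huniq _ (H.mem_spanBfB_mul _ (hα T)) ?_⟩, fun hX =>
    ⟨H.spanBfB_eq_top hX, fun b => huniq _ (by rw [H.spanBfB_eq_top hX]; trivial) (H.rep_incl t b)⟩⟩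
  · exact Subtype.ext ((hrep S).symm.trans ((congrArg (H.rep t) h).trans (hrep T)))
  · ext x
    constructor
    · rintro ⟨T, rfl⟩
      exact hα T
    · intro hx
      exact ⟨⟨H.rep t x, H.rep_mem t ht hx⟩, huniq _ hx rfl⟩
  · rw [rep_mul, rep_incl]
    exact congrArg (leftMul t b * ·) (hrep T)
  · rw [rep_mul, rep_incl]
    exact congrArg (· * leftMul t b) (hrep T)

end Representation

theorem exists_faithfulTrace_iso (H : IsFrobeniusInclusion h𝒞 i j v d) :
    ∃ (_ : FiniteDimensional ℂ (End P)) (t : FaithfulTrace (End P)),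
      t.toLinearMap = catTrace P ∧
      (∀ x ∈ spanBfB j (frobProj v d), ∀ c : End Q,
        c * x ∈ spanBfB j (frobProj v d) ∧ x * c ∈ spanBfB j (frobProj v d)) ∧
      ∃ α : basicConstruction i.range t →⋆ₙₐ[ℂ] End Q,
        Function.Injective α ∧
        Set.range α = (spanBfB j (frobProj v d) : Set (End Q)) ∧
        α (basicConstruction.jones _ t) = frobProj v d ∧
        (∀ (b : End P) (T : basicConstruction i.range t),
          α (basicConstruction.of _ t b * T) = j b * α T ∧
          α (T * basicConstruction.of _ t b) = α T * j b) ∧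
        ((∀ π : 𝒞, IsIrreducible π → IsSubobject π Q → IsSubobject π X) →
          spanBfB j (frobProj v d) = ⊤ ∧
          ∀ b : End P, α (basicConstruction.of _ t b) = j b) := by
  obtain ⟨t, ht⟩ := exists_faithfulTrace h𝒞 P
  have hfin := finiteDimensional_end h𝒞 P
  exact ⟨hfin, t, ht, fun x hx c => ⟨H.mul_mem_spanBfB c hx, H.mem_spanBfB_mul c hx⟩,
    H.exists_iso t ht⟩

end IsFrobeniusInclusion

end Ideal

/-! ### The two inclusions given by a standard pair -/

section Main

variable {𝒞 : Type u} [Category.{v} 𝒞] [MonoidalCategory 𝒞] [CStarCategory 𝒞]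
  [CStarTensorCategory 𝒞]

lemma inclRight_apply (X Y : 𝒞) (T : End X) :
    (inclRight X Y T : X ⊗ Y ⟶ X ⊗ Y) = (T : X ⟶ X) ▷ Y := tensorHom_id _ _

lemma inclLeft_apply (Y X : 𝒞) (T : End X) :
    (inclLeft Y X T : Y ⊗ X ⟶ Y ⊗ X) = Y ◁ (T : X ⟶ X) := id_tensorHom _ _

variable {σ σ' : 𝒞} {R : 𝟙_ 𝒞 ⟶ σ' ⊗ σ}
  {R' : 𝟙_ 𝒞 ⟶ σ ⊗ σ'}

/-- `1_X × R'`, as an element of `(X, (Xσ)σ')`. -/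
def rightCup (X : 𝒞) (R' : 𝟙_ 𝒞 ⟶ σ ⊗ σ') : X ⟶ (X ⊗ σ) ⊗ σ' :=
  (ρ_ X).inv ≫ X ◁ R' ≫ (α_ X σ σ').inv

/-- `R × 1_X`, as an element of `(X, σ'(σX))`. -/
def leftCup (X : 𝒞) (R : 𝟙_ 𝒞 ⟶ σ' ⊗ σ) : X ⟶ σ' ⊗ (σ ⊗ X) :=
  (λ_ X).inv ≫ R ▷ X ≫ (α_ σ' σ X).hom

lemma dag_rightCup (X : 𝒞) (R' : 𝟙_ 𝒞 ⟶ σ ⊗ σ') :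
    dag (rightCup X R') = (α_ X σ σ').hom ≫ X ◁ dag R' ≫ (ρ_ X).hom := by
  simp [rightCup, dag_comp]

lemma dag_leftCup (X : 𝒞) (R : 𝟙_ 𝒞 ⟶ σ' ⊗ σ) :
    dag (leftCup X R) = (α_ σ' σ X).inv ≫ dag R ▷ X ≫ (λ_ X).hom := by
  simp [leftCup, dag_comp]

lemma rightCup_comp_dag (X : 𝒞) {c : ℂ} (h : R' ≫ dag R' = c • 𝟙 (𝟙_ 𝒞)) :
    rightCup X R' ≫ dag (rightCup X R') = c • 𝟙 X := by
  rw [dag_rightCup, rightCup, Category.assoc, Category.assoc, Iso.inv_hom_id_assoc,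
    ← MonoidalCategory.whiskerLeft_comp_assoc, h]
  simp

lemma leftCup_comp_dag (X : 𝒞) {c : ℂ} (h : R ≫ dag R = c • 𝟙 (𝟙_ 𝒞)) :
    leftCup X R ≫ dag (leftCup X R) = c • 𝟙 X := by
  rw [dag_leftCup, leftCup, Category.assoc, Category.assoc, Iso.hom_inv_id_assoc,
    ← comp_whiskerRight_assoc, h]
  simp

lemma rightPartialTrace_eq (X : 𝒞) (R' : 𝟙_ 𝒞 ⟶ σ ⊗ σ') (T : X ⊗ σ ⟶ X ⊗ σ) :
    rightPartialTrace X R' T = rightCup X R' ≫ T ▷ σ' ≫ dag (rightCup X R') := by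
  rw [dag_rightCup, rightCup, rightPartialTrace]
  simp only [Category.assoc]

lemma leftPartialTrace_eq (X : 𝒞) (R : 𝟙_ 𝒞 ⟶ σ' ⊗ σ) (T : σ ⊗ X ⟶ σ ⊗ X) :
    leftPartialTrace X R T = leftCup X R ≫ σ' ◁ T ≫ dag (leftCup X R) := by
  rw [dag_leftCup, leftCup, leftPartialTrace]
  simp only [Category.assoc]

lemma statDim_tensor (h𝒞 : IsFiniteCStarTensorCategory 𝒞) (X Y : 𝒞) :
    statDim (X ⊗ Y) = statDim X * statDim Y := by
  obtain ⟨Y', S, S', hS⟩ := exists_standardPair h𝒞 Y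
  have h : (statDim (X ⊗ Y) : ℂ) = statDim X * statDim Y := by
    rw [statDim_eq h𝒞, ← canTrace_rightPartialTrace h𝒞 X hS, rightPartialTrace_eq,
      id_whiskerRight, Category.id_comp, rightCup_comp_dag X (hS.comp_dag_right h𝒞), map_smul,
      ← statDim_eq h𝒞, smul_eq_mul, mul_comm]
  exact_mod_cast h

lemma IsStandardPair.isFrobeniusInclusion_right (h𝒞 : IsFiniteCStarTensorCategory 𝒞)
    (hR : IsStandardPair σ σ' R R') (X : 𝒞) :
    IsFrobeniusInclusion h𝒞 (inclRight X σ) (inclRight (X ⊗ σ) σ') (rightCup X R')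
      (statDim σ) where
  pos := statDim_pos h𝒞 σ
  bijective := by
    have h := bijective_frobenius_right (hR.isConjugationPair h𝒞) X (X ⊗ σ)
    simp_rw [inclRight_apply, rightCup, Category.assoc]
    exact h
  comp_incl a := by
    rw [inclRight_apply, inclRight_apply, rightCup]
    simp only [Category.assoc]
    rw [← associator_inv_naturality_left, whisker_exchange_assoc, rightUnitor_inv_naturality_assoc]
  comp_dag := rightCup_comp_dag X (hR.comp_dag_right h𝒞)
  trace b := by
    rw [inclRight_apply, ← rightPartialTrace_eq, canTrace_rightPartialTrace h𝒞 X hR]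
  statDim_eq := by
    rw [statDim_tensor h𝒞 (X ⊗ σ), hR.statDim_conj h𝒞, mul_comm]

lemma IsStandardPair.isFrobeniusInclusion_left (h𝒞 : IsFiniteCStarTensorCategory 𝒞)
    (hR : IsStandardPair σ σ' R R') (X : 𝒞) :
    IsFrobeniusInclusion h𝒞 (inclLeft σ X) (inclLeft σ' (σ ⊗ X)) (leftCup X R)
      (statDim σ) where
  pos := statDim_pos h𝒞 σ
  bijective := by
    have h := bijective_frobenius_left (hR.isConjugationPair h𝒞) X (σ ⊗ X)
    simp_rw [inclLeft_apply, leftCup, Category.assoc]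
    exact h
  comp_incl a := by
    rw [inclLeft_apply, inclLeft_apply, leftCup]
    simp only [Category.assoc]
    rw [← associator_naturality_right, ← whisker_exchange_assoc,
      leftUnitor_inv_naturality_assoc]
  comp_dag := leftCup_comp_dag X (hR.comp_dag_left h𝒞)
  trace b := by
    rw [inclLeft_apply, ← leftPartialTrace_eq, canTrace_leftPartialTrace h𝒞 X hR]
  statDim_eq := by
    rw [statDim_tensor h𝒞 σ', hR.statDim_conj h𝒞]

lemma inclRight_injective (h𝒞 : IsFiniteCStarTensorCategory 𝒞) (X Y : 𝒞) :
    Function.Injective (inclRight X Y) := by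
  obtain ⟨Y', S, S', hS⟩ := exists_standardPair h𝒞 Y
  have hd : (statDim Y : ℂ) ≠ 0 := by exact_mod_cast (statDim_pos h𝒞 Y).ne'
  have hF := hS.isFrobeniusInclusion_right h𝒞 X
  intro a b hab
  have h1 : (a : X ⟶ X) ≫ rightCup X S' = (b : X ⟶ X) ≫ rightCup X S' := by
    rw [← hF.comp_incl, ← hF.comp_incl, hab]
  have h2 := congrArg (· ≫ dag (rightCup X S')) h1
  simp only [Category.assoc, hF.comp_dag, Linear.comp_smul, Category.comp_id] at h2
  exact smul_right_injective _ hd h2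

lemma inclLeft_injective (h𝒞 : IsFiniteCStarTensorCategory 𝒞) (Y X : 𝒞) :
    Function.Injective (inclLeft Y X) := by
  obtain ⟨Y', S, S', hS⟩ := exists_standardPair h𝒞 Y
  have hd : (statDim Y : ℂ) ≠ 0 := by exact_mod_cast (statDim_pos h𝒞 Y).ne'
  have hF := hS.isFrobeniusInclusion_left h𝒞 X
  intro a b hab
  have h1 : (a : X ⟶ X) ≫ leftCup X S = (b : X ⟶ X) ≫ leftCup X S := by
    rw [← hF.comp_incl, ← hF.comp_incl, hab]
  have h2 := congrArg (· ≫ dag (leftCup X S)) h1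
  simp only [Category.assoc, hF.comp_dag, Linear.comp_smul, Category.comp_id] at h2
  exact smul_right_injective _ hd h2

lemma projRight_eq (X : 𝒞) (R' : 𝟙_ 𝒞 ⟶ σ ⊗ σ') :
    projRight X σ σ' R' = frobProj (rightCup X R') (statDim σ) := by
  rw [projRight, frobProj, dag_rightCup, rightCup]
  simp

lemma projLeft_eq (X : 𝒞) (R : 𝟙_ 𝒞 ⟶ σ' ⊗ σ) :
    projLeft X σ σ' R = frobProj (leftCup X R) (statDim σ) := by
  rw [projLeft, frobProj, dag_leftCup, leftCup]
  simp

end Main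

end CStarTC

end

set_option maxHeartbeats 1000000 in
theorem lemma3p2 {𝒞 : Type u} [Category.{v} 𝒞] [MonoidalCategory 𝒞] [CStarCategory 𝒞]
    [CStarTensorCategory 𝒞] (h𝒞 : IsFiniteCStarTensorCategory 𝒞)
    (ρ σ σ' : 𝒞) (R : 𝟙_ 𝒞 ⟶ σ' ⊗ σ) (R' : 𝟙_ 𝒞 ⟶ σ ⊗ σ') (hR : IsStandardPair σ σ' R R') :
    -- the case `A = (ρ, ρ)`, `B = (ρσ, ρσ)`, `C = (ρσσ', ρσσ')`
    ((Function.Injective (inclRight ρ σ) ∧ Function.Injective (inclRight (ρ ⊗ σ) σ') ∧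
      FiniteDimensional ℂ (End ρ) ∧ FiniteDimensional ℂ (End ((ρ ⊗ σ) ⊗ σ')) ∧
      ∃ (_ : FiniteDimensional ℂ (End (ρ ⊗ σ))) (t : FaithfulTrace (End (ρ ⊗ σ))),
        t.toLinearMap = catTrace (ρ ⊗ σ) ∧
        (∀ x ∈ spanBfB (inclRight (ρ ⊗ σ) σ') (projRight ρ σ σ' R'),
          ∀ c : End ((ρ ⊗ σ) ⊗ σ'),
            c * x ∈ spanBfB (inclRight (ρ ⊗ σ) σ') (projRight ρ σ σ' R') ∧
            x * c ∈ spanBfB (inclRight (ρ ⊗ σ) σ') (projRight ρ σ σ' R')) ∧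
        ∃ α : basicConstruction (inclRight ρ σ).range t →⋆ₙₐ[ℂ] End ((ρ ⊗ σ) ⊗ σ'),
          Function.Injective α ∧
          Set.range α = (spanBfB (inclRight (ρ ⊗ σ) σ') (projRight ρ σ σ' R') :
            Set (End ((ρ ⊗ σ) ⊗ σ'))) ∧
          α (basicConstruction.jones _ t) = projRight ρ σ σ' R' ∧
          (∀ (b : End (ρ ⊗ σ)) (T : basicConstruction (inclRight ρ σ).range t),
            α (basicConstruction.of _ t b * T) = inclRight (ρ ⊗ σ) σ' b * α T ∧
            α (T * basicConstruction.of _ t b) = α T * inclRight (ρ ⊗ σ) σ' b) ∧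
          ((∀ π : 𝒞, IsIrreducible π → IsSubobject π ((ρ ⊗ σ) ⊗ σ') → IsSubobject π ρ) →
            spanBfB (inclRight (ρ ⊗ σ) σ') (projRight ρ σ σ' R') = ⊤ ∧
            ∀ b : End (ρ ⊗ σ), α (basicConstruction.of _ t b) = inclRight (ρ ⊗ σ) σ' b)) ∧
      ∀ X : End (ρ ⊗ σ),
        catTrace ((ρ ⊗ σ) ⊗ σ') (inclRight (ρ ⊗ σ) σ' X * projRight ρ σ σ' R') =
          1 / (statDim σ : ℂ) ^ 2 * catTrace (ρ ⊗ σ) X) ∧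
    -- the case `A = (ρ, ρ)`, `B = (σρ, σρ)`, `C = (σ'σρ, σ'σρ)`
    ((Function.Injective (inclLeft σ ρ) ∧ Function.Injective (inclLeft σ' (σ ⊗ ρ)) ∧
      FiniteDimensional ℂ (End ρ) ∧ FiniteDimensional ℂ (End (σ' ⊗ (σ ⊗ ρ))) ∧
      ∃ (_ : FiniteDimensional ℂ (End (σ ⊗ ρ))) (t : FaithfulTrace (End (σ ⊗ ρ))),
        t.toLinearMap = catTrace (σ ⊗ ρ) ∧
        (∀ x ∈ spanBfB (inclLeft σ' (σ ⊗ ρ)) (projLeft ρ σ σ' R),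
          ∀ c : End (σ' ⊗ (σ ⊗ ρ)),
            c * x ∈ spanBfB (inclLeft σ' (σ ⊗ ρ)) (projLeft ρ σ σ' R) ∧
            x * c ∈ spanBfB (inclLeft σ' (σ ⊗ ρ)) (projLeft ρ σ σ' R)) ∧
        ∃ α : basicConstruction (inclLeft σ ρ).range t →⋆ₙₐ[ℂ] End (σ' ⊗ (σ ⊗ ρ)),
          Function.Injective α ∧
          Set.range α = (spanBfB (inclLeft σ' (σ ⊗ ρ)) (projLeft ρ σ σ' R) :
            Set (End (σ' ⊗ (σ ⊗ ρ)))) ∧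
          α (basicConstruction.jones _ t) = projLeft ρ σ σ' R ∧
          (∀ (b : End (σ ⊗ ρ)) (T : basicConstruction (inclLeft σ ρ).range t),
            α (basicConstruction.of _ t b * T) = inclLeft σ' (σ ⊗ ρ) b * α T ∧
            α (T * basicConstruction.of _ t b) = α T * inclLeft σ' (σ ⊗ ρ) b) ∧
          ((∀ π : 𝒞, IsIrreducible π → IsSubobject π (σ' ⊗ (σ ⊗ ρ)) → IsSubobject π ρ) →
            spanBfB (inclLeft σ' (σ ⊗ ρ)) (projLeft ρ σ σ' R) = ⊤ ∧
            ∀ b : End (σ ⊗ ρ), α (basicConstruction.of _ t b) = inclLeft σ' (σ ⊗ ρ) b)) ∧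
      ∀ X : End (σ ⊗ ρ),
        catTrace (σ' ⊗ (σ ⊗ ρ)) (inclLeft σ' (σ ⊗ ρ) X * projLeft ρ σ σ' R) =
          1 / (statDim σ : ℂ) ^ 2 * catTrace (σ ⊗ ρ) X) := by
  have hr := hR.isFrobeniusInclusion_right h𝒞 ρ
  have hl := hR.isFrobeniusInclusion_left h𝒞 ρ
  rw [projRight_eq, projLeft_eq]
  exact ⟨⟨⟨inclRight_injective h𝒞 ρ σ, inclRight_injective h𝒞 (ρ ⊗ σ) σ',
      finiteDimensional_end h𝒞 ρ, finiteDimensional_end h𝒞 _, hr.exists_faithfulTrace_iso⟩,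
      hr.markov⟩,
    ⟨inclLeft_injective h𝒞 σ ρ, inclLeft_injective h𝒞 σ' (σ ⊗ ρ),
      finiteDimensional_end h𝒞 ρ, finiteDimensional_end h𝒞 _, hl.exists_faithfulTrace_iso⟩,
    hl.markov⟩
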